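/- For $m\ge 3$ let $W_m$ be the wheel on $m+1$ vertices, that is, the cycle $C_m$ together with one further vertex (the hub) adjacent to every vertex of the cycle, and for $n\ge 1$ let $S_n=K_{1,n-1}$ be the star on $n$ vertices. For finite graphs $G_1,G_2$, the Ramsey number $R(G_1,G_2)$ is the smallest positive integer $N$ such that for every simple graph $G$ on $N$ vertices, $G$ contains $G_1$ as a (not necessarily induced) subgraph or the complement $\overline{G}$ contains $G_2$ as a subgraph. Theorem. For every even integer $n\ge 6$, the Ramsey number $R(W_n,S_n)$ exists and satisfies $$R(W_n,S_n)\le \frac{5n}{2}-1 .$$ Equivalently, for every simple graph $G$ on $\frac{5n}{2}-1$ vertices, $G$ contains $W_n$ as a subgraph or $\overline{G}$ contains $S_n$ as a subgraph. -/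

import Mathlib

open SimpleGraph

/-- The join `G₁ + G₂`: the disjoint union of the two graphs together with all edges between
the two vertex sets. -/
def graphJoin {V W : Type*} (G₁ : SimpleGraph V) (G₂ : SimpleGraph W) : SimpleGraph (V ⊕ W) :=
  (G₁ ⊕g G₂) ⊔ completeBipartiteGraph V W

/-- The wheel `W_m = C_m + K_1`, with `m + 1` vertices. -/
def wheelGraph (m : ℕ) : SimpleGraph (Fin m ⊕ Fin 1) :=
  graphJoin (cycleGraph m) (completeGraph (Fin 1))

/-- The star `S_n = K_{1,n-1}` of order `n` (for `n ≥ 1`). -/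
def starOfOrder (n : ℕ) : SimpleGraph (Fin 1 ⊕ Fin (n - 1)) :=
  completeBipartiteGraph (Fin 1) (Fin (n - 1))

/-- `R` is the Ramsey number `R(G₁, G₂)`: the smallest positive integer `N` such that every
graph on `N` vertices contains `G₁` as a (not necessarily induced) subgraph, or its complement
contains `G₂`. Being a least element, such an `R` is unique, and it belongs to the set. -/
def IsRamseyNumber {V W : Type*} (G₁ : SimpleGraph V) (G₂ : SimpleGraph W) (R : ℕ) : Prop :=
  IsLeast {N : ℕ | 0 < N ∧ ∀ G : SimpleGraph (Fin N), G₁ ⊑ G ∨ G₂ ⊑ Gᶜ} R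

/-!
Write `n = 2 * k`, and suppose that the complement of a graph `G` on `5 * k - 1` vertices contains no
star on `n` vertices: every vertex misses at most `2 * k - 2` others. The neighbourhood of each
vertex has at least `3 * k` vertices, and a subgraph induced by `3 * k` vertices has minimum degree
at least `k + 1`. A wheel is a vertex together with a cycle on `2 * k` vertices in its neighbourhood.

The main tool is `exists_sparse_cut`: a graph on `3 * k` vertices with minimum degree at least
`k + 1` and without a cycle on `2 * k` vertices splits into two sides of size at least `k + 1` with
at most `2 * k - 2` edges in between. To see this, take an even cycle `C` of the largest length
`2 * p < 2 * k`; by `exists_even_cycle`, `2 * p ≥ k`. By maximality, the numbers of neighbours on `C`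
of the vertices of a path disjoint from `C` add up to at most `2 * p`, if the path has at most
`k + p` vertices (`sum_card_adj_cycle_le`), and at most one vertex off `C` has more than `p`
neighbours on `C` (`hasCycle_of_two_insertions`). From these two facts and the lack of longer even
cycles, a longest path in the complement of `C`, with Pósa rotations and Ore's crossing argument,
yields one side of the cut (`exists_sparse_cut_of_weights`).

If `G` contained no wheel, every set of `3 * k` neighbours of a vertex would have a sparse cut. Take
such a cut `(A, B)` with `B` the larger side. Some `h ∈ A` has at most one neighbour in `B`, hence at
least `k` neighbours in `A`; choose `k` of them and take a sparse cut of a set of `3 * k` neighbours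
of `h` that contains these. On average, the `k` chosen vertices have few neighbours in `B` and few on
the other side of the second cut. As these two sets are nearly disjoint and large, some vertex
misses more than `2 * k - 2` others, a contradiction (`exists_cycle_in_neighborhood`).
-/

/-! ### Paths and cycles as functions on the natural numbers -/

/-- `IsPathFun G s f` says that `f 0, …, f (s - 1)` are the vertices of a path of `G`, in order.
The values of `f` at arguments `≥ s` are irrelevant. -/
def IsPathFun {V : Type*} (G : SimpleGraph V) (s : ℕ) (f : ℕ → V) : Prop :=
  (∀ i j, i < s → j < s → f i = f j → i = j) ∧ ∀ i, i + 1 < s → G.Adj (f i) (f (i + 1))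

/-- `HasCycle G m` says that `G` contains a cycle with exactly `m` vertices. -/
def HasCycle {V : Type*} (G : SimpleGraph V) (m : ℕ) : Prop :=
  3 ≤ m ∧ ∃ f, IsPathFun G m f ∧ G.Adj (f (m - 1)) (f 0)

namespace IsPathFun

variable {V : Type*} {G : SimpleGraph V} {s t : ℕ} {f g : ℕ → V}

theorem single (v : V) : IsPathFun G 1 (fun _ => v) :=
  ⟨fun i j hi hj _ => by omega, fun i hi => by omega⟩

theorem reverse (hf : IsPathFun G s f) : IsPathFun G s (fun i => f (s - 1 - i)) := by
  refine ⟨fun i j hi hj h => ?_, fun i hi => ?_⟩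
  · have := hf.1 _ _ (by omega) (by omega) h
    omega
  · have := hf.2 (s - 1 - (i + 1)) (by omega)
    rw [show s - 1 - (i + 1) + 1 = s - 1 - i by omega] at this
    exact this.symm

theorem sub (hf : IsPathFun G s f) (a : ℕ) (h : a + t ≤ s) :
    IsPathFun G t (fun i => f (a + i)) := by
  refine ⟨fun i j hi hj h => ?_, fun i hi => ?_⟩
  · have := hf.1 _ _ (by omega) (by omega) h
    omega
  · exact hf.2 (a + i) (by omega)

theorem take (hf : IsPathFun G s f) (h : t ≤ s) : IsPathFun G t f :=
  ⟨fun i j hi hj => hf.1 i j (by omega) (by omega), fun i hi => hf.2 i (by omega)⟩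

theorem append (hf : IsPathFun G s f) (hg : IsPathFun G t g) (hs : 0 < s)
    (hd : ∀ i j, i < s → j < t → f i ≠ g j) (h : G.Adj (f (s - 1)) (g 0)) :
    IsPathFun G (s + t) (fun i => if i < s then f i else g (i - s)) := by
  refine ⟨fun i j hi hj h => ?_, fun i hi => ?_⟩
  · dsimp only at h
    split_ifs at h with h1 h2 h2
    · exact hf.1 i j h1 h2 h
    · exact absurd h (hd _ _ h1 (by omega))
    · exact absurd h.symm (hd _ _ h2 (by omega))
    · have := hg.1 _ _ (by omega) (by omega) h
      omega
  · dsimp only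
    split_ifs with h1 h2 h2
    · exact hf.2 i h2
    · rw [show i = s - 1 by omega, show s - 1 + 1 - s = 0 by omega]
      exact h
    · omega
    · rw [show i + 1 - s = i - s + 1 by omega]
      exact hg.2 _ (by omega)

/-- Two disjoint paths whose ends are joined crosswise by edges form a cycle. -/
theorem hasCycle_join (hf : IsPathFun G s f) (hg : IsPathFun G t g) (hs : 0 < s) (ht : 0 < t)
    (hst : 3 ≤ s + t) (hd : ∀ i j, i < s → j < t → f i ≠ g j)
    (h : G.Adj (f (s - 1)) (g 0)) (h' : G.Adj (g (t - 1)) (f 0)) : HasCycle G (s + t) := by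
  refine ⟨hst, _, hf.append hg hs hd h, ?_⟩
  rw [if_neg (by omega), if_pos hs, show s + t - 1 - s = t - 1 by omega]
  exact h'

theorem length_le [Fintype V] (hf : IsPathFun G s f) : s ≤ Fintype.card V := by
  have := Finset.card_le_card_of_injOn (s := Finset.range s) (t := Finset.univ) f (by simp)
    (fun i hi j hj h => hf.1 i j (by simpa using hi) (by simpa using hj) h)
  simpa using this

/-- Pósa rotation: if the first vertex of a path is adjacent to the `i`-th, then reversing the
initial segment gives a path with the same last vertex which starts at the `(i - 1)`-st. -/
theorem rotate (hf : IsPathFun G s f) {i : ℕ} (hi : i < s)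
    (h : G.Adj (f 0) (f i)) :
    IsPathFun G s (fun j => if j < i then f (i - 1 - j) else f j) := by
  refine ⟨fun a b ha hb hab => ?_, fun a ha => ?_⟩
  · dsimp only at hab
    split_ifs at hab with h1 h2 h2
    all_goals
      have := hf.1 _ _ (by omega) (by omega) hab
      omega
  · dsimp only
    split_ifs with h1 h2 h2
    · have := hf.2 (i - 1 - (a + 1)) (by omega)
      rw [show i - 1 - (a + 1) + 1 = i - 1 - a by omega] at this
      exact this.symm
    · rw [show i - 1 - a = 0 by omega, show a + 1 = i by omega]
      exact h
    · omega
    · exact hf.2 a ha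

/-- Starting a closed path at another of its vertices. -/
theorem cyclicShift (hf : IsPathFun G s f) (h : G.Adj (f (s - 1)) (f 0)) (a : ℕ) :
    IsPathFun G s (fun i => f ((a + i) % s)) := by
  refine ⟨fun i j hi hj hij => ?_, fun i hi => ?_⟩
  · have := hf.1 _ _ (Nat.mod_lt _ (by omega)) (Nat.mod_lt _ (by omega)) hij
    have h2 : i ≡ j [MOD s] := Nat.ModEq.add_left_cancel' a this
    rwa [Nat.ModEq, Nat.mod_eq_of_lt hi, Nat.mod_eq_of_lt hj] at h2
  · dsimp only
    have hlt : (a + i) % s < s := Nat.mod_lt _ (by omega)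
    by_cases h1 : (a + i) % s + 1 < s
    · have : (a + (i + 1)) % s = (a + i) % s + 1 := by
        rw [← add_assoc, Nat.add_mod, Nat.mod_eq_of_lt (show 1 < s by omega),
          Nat.mod_eq_of_lt h1]
      rw [this]
      exact hf.2 _ h1
    · have h2 : (a + i) % s = s - 1 := by omega
      have : (a + (i + 1)) % s = 0 := by
        rw [← add_assoc, Nat.add_mod, h2, Nat.mod_eq_of_lt (show 1 < s by omega),
          show s - 1 + 1 = s by omega, Nat.mod_self]
      rw [this, h2]
      exact h

/-- Ore's crossing argument: if the ends of a path have at least as many neighbours on the path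
as it has vertices, then its vertices are the vertices of a cycle. -/
theorem exists_closed (hf : IsPathFun G s f) (hs : 2 ≤ s) [DecidableRel G.Adj]
    (h : s ≤ ((Finset.range s).filter fun i => G.Adj (f 0) (f i)).card +
      ((Finset.range s).filter fun i => G.Adj (f (s - 1)) (f i)).card) :
    ∃ g, IsPathFun G s g ∧ G.Adj (g (s - 1)) (g 0) ∧ ∀ i < s, ∃ j < s, g i = f j := by
  classical
  obtain ⟨j, hj1, hj2, hjs⟩ : ∃ j, G.Adj (f 0) (f (j + 1)) ∧ G.Adj (f (s - 1)) (f j) ∧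
      j + 1 < s := by
    by_contra! hcon
    have h1 : ((Finset.range s).filter fun i => G.Adj (f 0) (f i)).card ≤
        ((Finset.range (s - 1)).filter fun j => G.Adj (f 0) (f (j + 1))).card := by
      refine Finset.card_le_card_of_injOn (fun i => i - 1) ?_ ?_
      · intro i hi
        simp only [Finset.coe_filter, Finset.mem_range, Set.mem_ofPred_eq] at hi ⊢
        have : i ≠ 0 := by
          rintro rfl
          exact hi.2.ne rfl
        refine ⟨by omega, ?_⟩
        rw [show i - 1 + 1 = i by omega]
        exact hi.2
      · intro i hi i' hi' hii
        simp only [Finset.coe_filter, Finset.mem_range, Set.mem_ofPred_eq] at hi hi' hii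
        have : i ≠ 0 := by
          rintro rfl
          exact hi.2.ne rfl
        have : i' ≠ 0 := by
          rintro rfl
          exact hi'.2.ne rfl
        omega
    have h2 : ((Finset.range s).filter fun i => G.Adj (f (s - 1)) (f i)) ⊆
        (Finset.range (s - 1)).filter fun j => ¬ G.Adj (f 0) (f (j + 1)) := by
      intro i hi
      simp only [Finset.mem_filter, Finset.mem_range] at hi ⊢
      have : i ≠ s - 1 := by
        rintro rfl
        exact hi.2.ne rfl
      refine ⟨by omega, fun h => ?_⟩
      have := hcon i h hi.2
      omega
    have h3 := Finset.card_le_card h2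
    have h4 := Finset.card_filter_add_card_filter_not (s := Finset.range (s - 1))
      (fun j => G.Adj (f 0) (f (j + 1)))
    rw [Finset.card_range] at h4
    omega
  have hg := (hf.take (t := j + 1) (by omega)).append
    ((hf.sub (t := s - (j + 1)) (j + 1) (by omega)).reverse) (by omega)
    (fun a b ha hb hab => by
      have := hf.1 _ _ (by omega) (by omega) hab
      omega)
    (by
      rw [show j + 1 + (s - (j + 1) - 1 - 0) = s - 1 by omega, show j + 1 - 1 = j by omega]
      exact hj2.symm)
  rw [show j + 1 + (s - (j + 1)) = s by omega] at hg
  refine ⟨_, hg, ?_, fun i hi => ?_⟩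
  · rw [if_neg (by omega), if_pos (by omega),
      show j + 1 + (s - (j + 1) - 1 - (s - 1 - (j + 1))) = j + 1 by omega]
    exact hj1.symm
  · split_ifs with h1
    · exact ⟨i, hi, rfl⟩
    · exact ⟨_, by omega, rfl⟩

end IsPathFun

/-- A finite graph has a longest path. -/
theorem exists_longest_path {V : Type*} [Fintype V] [Nonempty V] (G : SimpleGraph V) :
    ∃ q, 1 ≤ q ∧ (∃ f, IsPathFun G q f) ∧ ∀ f, ¬ IsPathFun G (q + 1) f := by
  classical
  have hex : ∃ n, ∀ f, ¬ IsPathFun G n f :=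
    ⟨Fintype.card V + 1, fun f hf => by have := hf.length_le; omega⟩
  have h0 := Nat.find_spec hex
  have hmin := fun m => Nat.find_min hex (m := m)
  set n := Nat.find hex
  have hn : 2 ≤ n := by
    by_contra hlt
    obtain ⟨v⟩ := ‹Nonempty V›
    exact h0 _ ((IsPathFun.single (G := G) v).take (by omega))
  refine ⟨n - 1, by omega, ?_, ?_⟩
  · have := hmin (n - 1) (by omega)
    push Not at this
    exact this
  · rw [show n - 1 + 1 = n by omega]
    exact h0

/-- All neighbours of the first vertex of a longest path lie on the path. -/
theorem mem_of_adj_head {V : Type*} {G : SimpleGraph V} {q : ℕ}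
    (hmax : ∀ f, ¬ IsPathFun G (q + 1) f) {f : ℕ → V} (hf : IsPathFun G q f) {w : V}
    (hw : G.Adj (f 0) w) : ∃ i < q, w = f i := by
  by_contra! hcon
  have := (IsPathFun.single (G := G) w).append hf (by omega)
    (fun i j _ hj => hcon j hj) hw.symm
  rw [add_comm] at this
  exact hmax _ this

theorem degree_head_le {V : Type*} [Fintype V] {G : SimpleGraph V} [DecidableRel G.Adj] {q : ℕ}
    (hmax : ∀ f, ¬ IsPathFun G (q + 1) f) {f : ℕ → V} (hf : IsPathFun G q f) :
    G.degree (f 0) ≤ ((Finset.range q).filter fun i => G.Adj (f 0) (f i)).card := by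
  classical
  rw [← G.card_neighborFinset_eq_degree]
  refine (Finset.card_le_card (t := ((Finset.range q).filter fun i => G.Adj (f 0) (f i)).image f)
    fun w hw => ?_).trans Finset.card_image_le
  rw [mem_neighborFinset] at hw
  obtain ⟨i, hi, rfl⟩ := mem_of_adj_head hmax hf hw
  exact Finset.mem_image_of_mem _ (by simp [hi, hw])

/-! ### An even cycle of medium length -/

/-- Counting step for `exists_even_cycle`: a set of integers of one parity in `[m, M]` in which no
difference lies in `[k - 2, 2 * k - 2]` is a short cluster, or two clusters more than `2 * k - 2`
apart. -/
theorem two_mul_card_le_of_gap {k m M : ℕ} (hk : 3 ≤ k) (hM : M + 1 ≤ 3 * k)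
    (S : Finset ℕ) (hS : ∀ a ∈ S, m ≤ a ∧ a ≤ M ∧ a % 2 = m % 2)
    (hgap : ∀ a ∈ S, ∀ b ∈ S, a < b → b - a + 2 < k ∨ 2 * k < b - a + 2) :
    2 * S.card ≤ k - 1 ∨ m + 2 * k ≤ M ∧ 2 * S.card + m + 2 * k ≤ M + 4 := by
  classical
  have hcard : ∀ (T : Finset ℕ) (x y : ℕ), T ⊆ S → T.Nonempty → (∀ a ∈ T, x ≤ a ∧ a ≤ y) →
      x % 2 = m % 2 → 2 * T.card ≤ y - x + 2 := by
    intro T x y hT hne h hx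
    have : T.card ≤ (Finset.range ((y - x) / 2 + 1)).card := by
      refine Finset.card_le_card_of_injOn (fun a => (a - x) / 2) ?_ ?_
      · intro a ha
        have := h a ha
        simp only [Finset.coe_range, Set.mem_Iio]
        omega
      · intro a ha b hb hab
        have h1 := h a ha
        have h2 := h b hb
        have h3 := (hS a (hT ha)).2.2
        have h4 := (hS b (hT hb)).2.2
        dsimp only at hab
        omega
    rw [Finset.card_range] at this
    omega
  rcases S.eq_empty_or_nonempty with rfl | hne
  · left; simp
  set x := S.min' hne
  set y := S.max' hne
  have hx : x ∈ S := S.min'_mem hne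
  have hy : y ∈ S := S.max'_mem hne
  have hxy : ∀ a ∈ S, x ≤ a ∧ a ≤ y := fun a ha => ⟨S.min'_le a ha, S.le_max' a ha⟩
  have hxS := hS x hx
  have hyS := hS y hy
  by_cases hd : y - x + 2 < k
  · left
    have := hcard S x y (by rfl) hne hxy hxS.2.2
    omega
  right
  have hlt : x < y := by
    have := (hxy x hx).2
    omega
  have hbig := (hgap x hx y hy hlt).resolve_left hd
  set lo := S.filter fun a => a + 2 < k + x
  set hi := S.filter fun a => ¬ a + 2 < k + x
  have hlo : lo.Nonempty := ⟨x, by simp [lo, hx]; omega⟩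
  have hhi : hi.Nonempty := ⟨y, by simp [hi, hy]; omega⟩
  set a := lo.max' hlo
  set b := hi.min' hhi
  have ha : a ∈ lo := lo.max'_mem hlo
  have hb : b ∈ hi := hi.min'_mem hhi
  have h1 := hcard lo x a (Finset.filter_subset _ _) hlo
    (fun c hc => ⟨(hxy c (Finset.filter_subset _ _ hc)).1, lo.le_max' c hc⟩) hxS.2.2
  simp only [lo, hi, Finset.mem_filter] at ha hb
  have hbS := hS b hb.1
  have h2 := hcard hi b y (Finset.filter_subset _ _) hhi
    (fun c hc => ⟨hi.min'_le c hc, (hxy c (Finset.filter_subset _ _ hc)).2⟩) hbS.2.2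
  have h3 : lo.card + hi.card = S.card := Finset.card_filter_add_card_filter_not _
  have haS := hS a ha.1
  have hab := hgap a ha.1 b hb.1 (by omega)
  have hxa := hxy a ha.1
  have hyb := hxy b hb.1
  have hxb := hgap x hx b hb.1 (by omega)
  omega

/-- If `f` is a longest path and there is no even cycle with a length in `[k, 2 * k]`, then the path
is spanning and its first vertex is adjacent to the third and to the last one. -/
theorem adj_head_of_no_even_cycle {V : Type*} [Fintype V] {G : SimpleGraph V} [DecidableRel G.Adj]
    {k q : ℕ} (hk : 3 ≤ k) (hV : Fintype.card V = 3 * k) (hdeg : ∀ v, k + 1 ≤ G.degree v)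
    (hno : ∀ m, Even m → k ≤ m → m ≤ 2 * k → ¬ HasCycle G m)
    (hmax : ∀ f, ¬ IsPathFun G (q + 1) f) {f : ℕ → V} (hf : IsPathFun G q f) :
    q = 3 * k ∧ G.Adj (f 0) (f 2) ∧ G.Adj (f 0) (f (q - 1)) := by
  classical
  have hq := hf.length_le
  rw [hV] at hq
  set T := (Finset.range q).filter fun i => G.Adj (f 0) (f i)
  have hT : k + 1 ≤ T.card := (hdeg _).trans (degree_head_le hmax hf)
  have hmem : ∀ i ∈ T, i < q ∧ G.Adj (f 0) (f i) ∧ 1 ≤ i := by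
    intro i hi
    simp only [T, Finset.mem_filter, Finset.mem_range] at hi
    refine ⟨hi.1, hi.2, ?_⟩
    rcases Nat.eq_zero_or_pos i with rfl | h
    · exact absurd rfl hi.2.ne
    · exact h
  have hgap : ∀ a ∈ T, ∀ b ∈ T, a % 2 = b % 2 → a < b → b - a + 2 < k ∨ 2 * k < b - a + 2 := by
    intro a ha b hb hpar hab
    by_contra hcon
    have ha' := hmem a ha
    have hb' := hmem b hb
    -- the cycle consists of `f 0` and the segment from `f a` to `f b`
    refine hno (1 + (b - a + 1)) ?_ (by omega) (by omega)
      ((hf.take (t := 1) (by omega)).hasCycle_join (hf.sub (t := b - a + 1) a (by omega))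
        (by omega) (by omega) (by omega) (fun i j hi hj hij => ?_) ha'.2.1 ?_)
    · rw [Nat.even_iff]; omega
    · have := hf.1 _ _ (by omega) (by omega) hij
      omega
    · rw [show a + (b - a + 1 - 1) = b by omega]
      exact hb'.2.1.symm
  have hcard : ∀ m r M, m % 2 = r → M + 1 ≤ 3 * k → (∀ i ∈ T, i % 2 = r → m ≤ i) →
      (∀ i ∈ T, i ≤ M) → 2 * (T.filter fun i => i % 2 = r).card ≤ k - 1 ∨
        m + 2 * k ≤ M ∧ 2 * (T.filter fun i => i % 2 = r).card + m + 2 * k ≤ M + 4 := by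
    intro m r M hr hM h1 h2
    refine two_mul_card_le_of_gap hk hM _ (fun a ha => ?_) (fun a ha b hb => ?_)
    · rw [Finset.mem_filter] at ha
      exact ⟨h1 a ha.1 ha.2, h2 a ha.1, by omega⟩
    · rw [Finset.mem_filter] at ha hb
      exact hgap a ha.1 b hb.1 (by omega)
  have hsum : (T.filter fun i => i % 2 = 1).card + (T.filter fun i => i % 2 = 0).card =
      T.card := by
    rw [← Finset.card_filter_add_card_filter_not (s := T) (fun i => i % 2 = 1)]
    congr 2
    ext i
    simp
  have hodd : ∀ i ∈ T, i % 2 = 1 → 1 ≤ i := fun i hi _ => (hmem i hi).2.2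
  have heven : ∀ i ∈ T, i % 2 = 0 → 2 ≤ i := fun i hi _ => by
    have := (hmem i hi).2.2
    omega
  have hlast : 3 * k - 1 ∈ T := by
    by_contra hcon
    have hM : ∀ i ∈ T, i ≤ 3 * k - 2 := fun i hi => by
      have h1 := (hmem i hi).1
      have h2 : i ≠ 3 * k - 1 := by
        rintro rfl
        exact hcon hi
      omega
    have h1 := hcard 1 1 (3 * k - 2) rfl (by omega) hodd hM
    have h2 := hcard 2 0 (3 * k - 2) rfl (by omega) heven hM
    omega
  have htwo : 2 ∈ T := by
    by_contra hcon
    have hM : ∀ i ∈ T, i ≤ 3 * k - 1 := fun i hi => by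
      have h1 := (hmem i hi).1
      omega
    have h1 := hcard 1 1 (3 * k - 1) rfl (by omega) hodd hM
    have h2 := hcard 4 0 (3 * k - 1) rfl (by omega) (fun i hi hi2 => by
      have h1 := heven i hi hi2
      have h2 : i ≠ 2 := by
        rintro rfl
        exact hcon hi
      omega) hM
    omega
  have h1 := hmem _ hlast
  have hq' : q = 3 * k := by omega
  exact ⟨hq', (hmem _ htwo).2.1, by rw [hq']; exact h1.2.1⟩

/-- A graph on `3 * k` vertices with minimum degree at least `k + 1` has an even cycle of a length
between `k` and `2 * k`. In the extremal case of the counting argument the graph contains the square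
of a Hamiltonian cycle, and then it has a cycle of length `2 * k`. -/
theorem exists_even_cycle {V : Type*} [Fintype V] {G : SimpleGraph V} [DecidableRel G.Adj]
    {k : ℕ} (hk : 3 ≤ k) (hV : Fintype.card V = 3 * k) (hdeg : ∀ v, k + 1 ≤ G.degree v) :
    ∃ m, Even m ∧ k ≤ m ∧ m ≤ 2 * k ∧ HasCycle G m := by
  by_contra! hno
  have : Nonempty V := Fintype.card_pos_iff.mp (by omega)
  obtain ⟨q, hq1, ⟨f, hf⟩, hmax⟩ := exists_longest_path G
  obtain ⟨hq, -, hlast⟩ := adj_head_of_no_even_cycle hk hV hdeg hno hmax hf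
  have hsq : ∀ i, i + 2 < q → G.Adj (f i) (f (i + 2)) := by
    intro i hi
    have := (adj_head_of_no_even_cycle hk hV hdeg hno hmax (hf.cyclicShift hlast.symm i)).2.1
    rwa [add_zero, Nat.mod_eq_of_lt (by omega), Nat.mod_eq_of_lt hi] at this
  have h1 : IsPathFun G k fun i => f (2 * i) := by
    refine ⟨fun i j hi hj h => ?_, fun i hi => hsq _ (by omega)⟩
    have := hf.1 _ _ (by omega) (by omega) h
    omega
  have h2 : IsPathFun G k fun i => f (2 * i + 1) := by
    refine ⟨fun i j hi hj h => ?_, fun i hi => hsq _ (by omega)⟩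
    have := hf.1 _ _ (by omega) (by omega) h
    omega
  refine hno (k + k) ⟨k, rfl⟩ (by omega) (by omega)
    (h1.hasCycle_join h2.reverse (by omega) (by omega) (by omega) (fun i j hi hj h => ?_) ?_ ?_)
  · have := hf.1 _ _ (by omega) (by omega) h
    omega
  · have := hf.2 (2 * (k - 1)) (by omega)
    simpa using this
  · have := hf.2 0 (by omega)
    simpa using this.symm

/-! ### Longest paths and weights of closed paths -/

/-- `Ends G q a b` says that `G` has a path on `q` vertices from `a` to `b`. -/
def Ends {V : Type*} (G : SimpleGraph V) (q : ℕ) (a b : V) : Prop :=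
  ∃ f, IsPathFun G q f ∧ f 0 = a ∧ f (q - 1) = b

theorem Ends.symm {V : Type*} {G : SimpleGraph V} {q : ℕ} {a b : V} (h : Ends G q a b) :
    Ends G q b a := by
  obtain ⟨f, hf, rfl, rfl⟩ := h
  exact ⟨_, hf.reverse, rfl, by simp⟩

theorem image_eq_of_closed {R : Type*} {G : SimpleGraph R} [DecidableEq R] {f h : ℕ → R} {t : ℕ}
    (hf : IsPathFun G t f) (hh : IsPathFun G t h) (hsub : ∀ i < t, ∃ j < t, h i = f j) :
    (Finset.range t).image h = (Finset.range t).image f := by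
  have hcard : ∀ g, IsPathFun G t g → ((Finset.range t).image g).card = t := fun g hg => by
    rw [Finset.card_image_of_injOn, Finset.card_range]
    intro i hi j hj hij
    exact hg.1 i j (by simpa using hi) (by simpa using hj) hij
  refine Finset.eq_of_subset_of_card_le (fun x hx => ?_) (by rw [hcard f hf, hcard h hh])
  obtain ⟨i, hi, rfl⟩ := Finset.mem_image.mp hx
  obtain ⟨j, hj, hij⟩ := hsub i (Finset.mem_range.mp hi)
  rw [hij]
  exact Finset.mem_image_of_mem _ (Finset.mem_range.mpr hj)

theorem sum_image_path {R : Type*} {G : SimpleGraph R} [DecidableEq R] {f : ℕ → R} {t : ℕ}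
    (hf : IsPathFun G t f) (F : R → ℕ) :
    ∑ u ∈ (Finset.range t).image f, F u = ∑ i ∈ Finset.range t, F (f i) :=
  Finset.sum_image fun i hi j hj hij => hf.1 i j (by simpa using hi) (by simpa using hj) hij

/-- If every path on `w` vertices has weight at most `b`, then averaging over the windows of length
`w` bounds the weight of a longer closed path. -/
theorem sum_closed_le {R : Type*} {G : SimpleGraph R} {c : R → ℕ} {h : ℕ → R} {w b t : ℕ}
    (hw : w ≤ t)
    (hsum : ∀ f, IsPathFun G w f → ∑ i ∈ Finset.range w, c (f i) ≤ b)
    (hh : IsPathFun G t h) (hcl : G.Adj (h (t - 1)) (h 0)) :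
    w * ∑ i ∈ Finset.range t, c (h i) ≤ t * b := by
  rcases Nat.eq_zero_or_pos t with rfl | ht
  · simp
  have hrot : ∀ a, ∑ i ∈ Finset.range t, c (h ((i + a) % t)) = ∑ i ∈ Finset.range t, c (h i) := by
    intro a
    refine Finset.sum_nbij (fun i => (i + a) % t) (fun i _ => ?_) (fun i hi j hj hij => ?_)
      (fun i hi => ?_) (fun _ _ => rfl)
    · exact Finset.mem_range.mpr (Nat.mod_lt _ ht)
    · have h2 : i ≡ j [MOD t] := Nat.ModEq.add_right_cancel' a hij
      rwa [Nat.ModEq, Nat.mod_eq_of_lt (by simpa using hi), Nat.mod_eq_of_lt (by simpa using hj)]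
        at h2
    · refine ⟨(i + (t - a % t)) % t, by simpa using Nat.mod_lt _ ht, ?_⟩
      dsimp only
      have h1 : a % t < t := Nat.mod_lt _ ht
      have h2 : i + (t - a % t) + a % t = i + t := by omega
      rw [Nat.mod_add_mod, ← Nat.add_mod_mod, h2, Nat.add_mod_right,
        Nat.mod_eq_of_lt (by simpa using hi)]
  calc w * ∑ i ∈ Finset.range t, c (h i)
      = ∑ a ∈ Finset.range w, ∑ i ∈ Finset.range t, c (h ((i + a) % t)) := by
        rw [Finset.sum_congr rfl fun a _ => hrot a]
        simp
    _ = ∑ i ∈ Finset.range t, ∑ a ∈ Finset.range w, c (h ((i + a) % t)) := Finset.sum_comm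
    _ ≤ ∑ _i ∈ Finset.range t, b :=
        Finset.sum_le_sum fun i _ => hsum _ ((hh.cyclicShift hcl i).take hw)
    _ = t * b := by simp

/-! ### Sparse cuts from a weight that is small on paths

In this part, `R` is to be thought of as the complement of a longest even cycle, with `2 * p`
vertices, in a graph with `3 * k` vertices, and the weight `c r` as the number of neighbours of `r`
on that cycle. -/

section Weighted

variable {R : Type*} [Fintype R] {G : SimpleGraph R} [DecidableRel G.Adj] {c : R → ℕ} {k p q : ℕ}

/-- Rotating a longest path `f` with its last vertex fixed. Each neighbour `f i` of the first vertex
makes `f (i - 1)` the first vertex of another longest path, so `f (i - 1)` has weight at least `m`,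
and `N` such vertices among the first `k + p` have weight at most `2 * p` together. The neighbours
`f i` with `i > k + p` are few: `i` is even, since otherwise `f 0, …, f i` would be an even cycle of
forbidden length. -/
theorem rotation_bound (hqk : q ≤ 2 * k) (hdeg : ∀ r, k + 1 ≤ G.degree r + c r)
    (hsum : ∀ s f, s ≤ k + p → IsPathFun G s f → ∑ i ∈ Finset.range s, c (f i) ≤ 2 * p)
    (hno : ∀ m, Even m → 2 * p + 2 ≤ m → m ≤ 2 * k → ¬ HasCycle G m)
    (hmax : ∀ f, ¬ IsPathFun G (q + 1) f) {f : ℕ → R} (hf : IsPathFun G q f) (hq : 1 ≤ q) {m : ℕ}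
    (hm : ∀ e, Ends G q e (f (q - 1)) → m ≤ c e) :
    ∃ N, k + 1 ≤ c (f 0) + N + ((q - 1) / 2 - (k + p) / 2) ∧
      m * N + (if q ≤ k + p then c (f (q - 1)) else 0) ≤ 2 * p := by
  classical
  set T := (Finset.range q).filter fun i => G.Adj (f 0) (f i)
  have hT : G.degree (f 0) ≤ T.card := degree_head_le hmax hf
  have hmem : ∀ i ∈ T, i < q ∧ G.Adj (f 0) (f i) ∧ 1 ≤ i := by
    intro i hi
    simp only [T, Finset.mem_filter, Finset.mem_range] at hi
    refine ⟨hi.1, hi.2, ?_⟩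
    rcases Nat.eq_zero_or_pos i with rfl | h
    · exact absurd rfl hi.2.ne
    · exact h
  set T₁ := T.filter fun i => i ≤ k + p
  have hsplit : T₁.card + (T.filter fun i => ¬ i ≤ k + p).card = T.card :=
    Finset.card_filter_add_card_filter_not _
  have hfar : (T.filter fun i => ¬ i ≤ k + p).card ≤ (q - 1) / 2 - (k + p) / 2 := by
    rw [← Nat.card_Ioc]
    have heven : ∀ i ∈ T, k + p < i → i % 2 = 0 := by
      intro i hi hlt
      have hi' := hmem i hi
      by_contra hodd
      refine hno (i + 1) ?_ (by omega) (by omega)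
        ⟨by omega, f, hf.take (by omega), ?_⟩
      · rw [Nat.even_iff]; omega
      · simpa using hi'.2.1.symm
    refine Finset.card_le_card_of_injOn (fun i => i / 2) (fun i hi => ?_) (fun i hi j hj hij => ?_)
    · rw [Finset.mem_coe, Finset.mem_filter] at hi
      have h1 := hmem i hi.1
      have h2 := heven i hi.1 (by omega)
      simp only [Finset.coe_Ioc, Set.mem_Ioc]
      omega
    · rw [Finset.mem_coe, Finset.mem_filter] at hi hj
      have h1 := heven i hi.1 (by omega)
      have h2 := heven j hj.1 (by omega)
      dsimp only at hij
      omega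
  have hnear : m * T₁.card ≤ ∑ i ∈ Finset.range (min (q - 1) (k + p)), c (f i) := by
    have hinj : Set.InjOn (fun i : ℕ => i - 1) T₁ := by
      intro i hi j hj hij
      have h1 := hmem i (Finset.filter_subset _ _ hi)
      have h2 := hmem j (Finset.filter_subset _ _ hj)
      dsimp only at hij
      omega
    rw [← Finset.card_image_of_injOn hinj, mul_comm, ← smul_eq_mul]
    refine (Finset.card_nsmul_le_sum _ (fun i => c (f i)) m fun j hj => ?_).trans
      (Finset.sum_le_sum_of_subset fun j hj => ?_)
    · obtain ⟨i, hi, rfl⟩ := Finset.mem_image.mp hj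
      have h1 := hmem i (Finset.filter_subset _ _ hi)
      refine hm _ ⟨_, hf.rotate h1.1 h1.2.1, ?_, ?_⟩
      · rw [if_pos (by omega), Nat.sub_zero]
      · rw [if_neg (by omega)]
    · obtain ⟨i, hi, rfl⟩ := Finset.mem_image.mp hj
      have h1 := hmem i (Finset.filter_subset _ _ hi)
      have h2 := (Finset.mem_filter.mp hi).2
      rw [Finset.mem_range]
      omega
  refine ⟨T₁.card, ?_, ?_⟩
  · have := hdeg (f 0)
    omega
  · split_ifs with h
    · have h1 := hsum q f h hf
      rw [show q = q - 1 + 1 by omega, Finset.sum_range_succ] at h1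
      rw [min_eq_left (by omega)] at hnear
      have h2 : q - 1 + 1 - 1 = q - 1 := by omega
      omega
    · have h1 := hsum _ f (min_le_right (q - 1) (k + p)) (hf.take (by omega))
      omega

/-- The rotation bound excludes that the least weight `m` of a partner `a` of `b`, as an end of a
longest path, satisfies `2 ≤ m ≤ p`. The hypothesis `hopen` holds when no longest path can be closed
to a cycle on the same vertices, by Ore's argument. -/
theorem ends_dichotomy (hk : 3 ≤ k) (hpk : p < k) (hkp : k ≤ 2 * p)
    (hcard : Fintype.card R + 2 * p = 3 * k) (hdeg : ∀ r, k + 1 ≤ G.degree r + c r)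
    (hsum : ∀ s f, s ≤ k + p → IsPathFun G s f → ∑ i ∈ Finset.range s, c (f i) ≤ 2 * p)
    (hno : ∀ m, Even m → 2 * p + 2 ≤ m → m ≤ 2 * k → ¬ HasCycle G m) (hq : 1 ≤ q)
    (hmax : ∀ f, ¬ IsPathFun G (q + 1) f)
    (hopen : ∀ a b, Ends G q a b → 2 * k + 3 ≤ q + c a + c b) (b : R) :
    (∃ a, Ends G q a b ∧ c a ≤ 1) ∨ ∀ a, Ends G q a b → p + 1 ≤ c a := by
  by_contra! hcon
  obtain ⟨h2, a₀, ha₀, hap⟩ := hcon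
  obtain ⟨a, ha, hamin⟩ := Set.exists_min_image {a | Ends G q a b} c (Set.toFinite _) ⟨a₀, ha₀⟩
  have ham : c a ≤ p := by
    have := hamin a₀ ha₀
    omega
  have ha2 := h2 a ha
  have hs := hopen a b ha
  obtain ⟨f, hf, rfl, rfl⟩ := ha
  have hqR := hf.length_le
  obtain ⟨N, hN, hmN⟩ := rotation_bound (by omega) hdeg hsum hno hmax hf hq
    (m := c (f 0)) hamin
  generalize c (f 0) = m at *
  generalize c (f (q - 1)) = β at *
  split_ifs at hmN with h
  · have hN' : k + 1 - m ≤ N := by omega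
    have h3 : m * (k + 1 - m) ≤ m * N := Nat.mul_le_mul_left _ hN'
    obtain ⟨d, rfl⟩ : ∃ d, k = m + d + 1 := ⟨k - m - 1, by omega⟩
    obtain ⟨e, rfl⟩ : ∃ e, m = e + 2 := ⟨m - 2, by omega⟩
    rw [show e + 2 + d + 1 + 1 - (e + 2) = d + 2 by omega] at h3
    have h4 : (e + 2) * (d + 2) = e * d + 2 * e + 2 * d + 4 := by ring
    have h5 : 0 ≤ e * d := Nat.zero_le _
    omega
  · set B := (q - 1) / 2 - (k + p) / 2
    rcases Nat.lt_or_ge p 3 with hp | hp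
    · have hp2 : p = 2 := by omega
      have hk4 : k ≤ 4 := by omega
      subst hp2
      have hm2 : m = 2 := by omega
      subst hm2
      omega
    · have h6 : 3 * p + 2 ≤ 2 * m + 2 * N := by omega
      obtain ⟨e, rfl⟩ : ∃ e, m = e + 2 := ⟨m - 2, by omega⟩
      obtain ⟨d, rfl⟩ : ∃ d, p = e + 2 + d := ⟨p - (e + 2), by omega⟩
      have h7 : (e + 2) * (3 * (e + 2 + d) + 2) ≤ (e + 2) * (2 * (e + 2) + 2 * N) :=
        Nat.mul_le_mul_left _ h6
      nlinarith [Nat.zero_le (e * d), Nat.zero_le (e * e)]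

/-- If some longest path closes to a cycle, then its vertex set `K` has no neighbours outside, and
the bound on the weight of paths bounds the weight of `K`. -/
theorem sparse_of_closed (hk : 3 ≤ k) (hpk : p < k) (hkp : k ≤ 2 * p)
    (hcard : Fintype.card R + 2 * p = 3 * k) (hdeg : ∀ r, k + 1 ≤ G.degree r + c r)
    (hsum : ∀ s f, s ≤ k + p → IsPathFun G s f → ∑ i ∈ Finset.range s, c (f i) ≤ 2 * p)
    (hq : 2 ≤ q) (hmax : ∀ f, ¬ IsPathFun G (q + 1) f) {h : ℕ → R} (hh : IsPathFun G q h)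
    (hcl : G.Adj (h (q - 1)) (h 0)) [DecidableEq R] :
    ∃ K : Finset R, k ≤ K.card ∧
      ∑ u ∈ K, (c u + (Finset.univ.filter fun w => w ∉ K ∧ G.Adj u w).card) ≤ 2 * k - 2 := by
  set K := (Finset.range q).image h
  have hKc : K.card = q := by
    rw [Finset.card_image_of_injOn, Finset.card_range]
    intro i hi j hj hij
    exact hh.1 i j (by simpa using hi) (by simpa using hj) hij
  have hout : ∀ u ∈ K, ∀ w, G.Adj u w → w ∈ K := by
    intro u hu w hw
    obtain ⟨i, hi, rfl⟩ := Finset.mem_image.mp hu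
    have hi' := Finset.mem_range.mp hi
    have hsh := hh.cyclicShift hcl i
    obtain ⟨j, hj, rfl⟩ := mem_of_adj_head hmax hsh (w := w)
      (by rwa [add_zero, Nat.mod_eq_of_lt hi'])
    exact Finset.mem_image_of_mem _ (Finset.mem_range.mpr (Nat.mod_lt _ (by omega)))
  have hqR := hh.length_le
  refine ⟨K, ?_, ?_⟩
  -- a small `K` would have too large a weight, since all neighbours within `R` lie in `K`
  · by_contra hlt
    have hcq : ∀ i ∈ Finset.range q, k + 2 - q ≤ c (h i) := by
      intro i hi
      have h1 := hdeg (h i)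
      have h2 : G.degree (h i) ≤ (K.erase (h i)).card := by
        rw [← G.card_neighborFinset_eq_degree]
        refine Finset.card_le_card fun w hw => ?_
        rw [mem_neighborFinset] at hw
        exact Finset.mem_erase.mpr ⟨hw.ne', hout _ (Finset.mem_image_of_mem _ hi) _ hw⟩
      have h4 : h i ∈ K := Finset.mem_image_of_mem _ hi
      rw [Finset.card_erase_of_mem h4] at h2
      omega
    have h1 := Finset.card_nsmul_le_sum _ _ _ hcq
    have h2 := hsum q h (by omega) hh
    rw [Finset.card_range, smul_eq_mul] at h1
    obtain ⟨a, rfl⟩ : ∃ a, q = a + 2 := ⟨q - 2, by omega⟩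
    obtain ⟨b, rfl⟩ : ∃ b, k = a + b + 3 := ⟨k - a - 3, by omega⟩
    rw [show a + b + 3 + 2 - (a + 2) = b + 3 by omega] at h1
    nlinarith [Nat.zero_le (a * b)]
  · have hzero : ∀ u ∈ K, c u + (Finset.univ.filter fun w => w ∉ K ∧ G.Adj u w).card = c u := by
      intro u hu
      rw [Nat.add_eq_left, Finset.card_eq_zero, Finset.filter_eq_empty_iff]
      exact fun w _ hw => hw.1 (hout u hu w hw.2)
    rw [Finset.sum_congr rfl hzero, sum_image_path hh]
    rcases le_total q (k + p) with hle | hle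
    · have := hsum q h hle hh
      omega
    · have h1 := sum_closed_le hle (fun f hf => hsum _ f le_rfl hf) hh hcl
      set S := ∑ i ∈ Finset.range q, c (h i)
      by_contra hlt
      have h2 : 2 * k ≤ S + 1 := by omega
      have h3 : q + 2 * p ≤ 3 * k := by omega
      zify at h1 h2 h3 hk hpk hkp
      nlinarith [sq_nonneg ((k : ℤ) - 2 * p)]

/-- A set `K` of at least `k` vertices whose weight and outgoing edges number at most `2 * k - 2`
in total. If no longest path can be closed, the dichotomy for the ends and the uniqueness of a
vertex of weight above `p` give a longest path from a vertex of weight at most `1` to the vertex `r`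
of weight above `p`. Then `r` has degree at most `1`, the rest of the path closes to a cycle, and
its vertex set serves as `K`. -/
theorem exists_sparse_cut_of_weights (hk : 3 ≤ k) (hpk : p < k) (hkp : k ≤ 2 * p)
    (hcard : Fintype.card R + 2 * p = 3 * k) (hdeg : ∀ r, k + 1 ≤ G.degree r + c r)
    (hsum : ∀ s f, s ≤ k + p → IsPathFun G s f → ∑ i ∈ Finset.range s, c (f i) ≤ 2 * p)
    (huniq : ∀ r r', p + 1 ≤ c r → p + 1 ≤ c r' → r = r')
    (hno : ∀ m, Even m → 2 * p + 2 ≤ m → m ≤ 2 * k → ¬ HasCycle G m) [DecidableEq R] :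
    ∃ K : Finset R, k ≤ K.card ∧
      ∑ u ∈ K, (c u + (Finset.univ.filter fun w => w ∉ K ∧ G.Adj u w).card) ≤ 2 * k - 2 := by
  have hne : Nonempty R := Fintype.card_pos_iff.mp (by omega)
  obtain ⟨q, hq1, ⟨f, hf⟩, hmax⟩ := exists_longest_path G
  by_cases hclosed : ∃ h, 2 ≤ q ∧ IsPathFun G q h ∧ G.Adj (h (q - 1)) (h 0)
  · obtain ⟨h, hq, hh, hcl⟩ := hclosed
    exact sparse_of_closed hk hpk hkp hcard hdeg hsum hq hmax hh hcl
  have hq2 : 2 ≤ q := by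
    by_contra hlt
    have hq : q = 1 := by omega
    subst hq
    have hbig : ∀ r, p + 1 ≤ c r := by
      intro r
      have h1 := hdeg r
      have h2 := degree_head_le hmax (IsPathFun.single (G := G) r)
      simp at h2
      omega
    obtain ⟨r, r', hr⟩ := Fintype.exists_pair_of_one_lt_card (α := R) (by omega)
    exact hr (huniq _ _ (hbig r) (hbig r'))
  have hqR := hf.length_le
  have hopen : ∀ a b, Ends G q a b → 2 * k + 3 ≤ q + c a + c b := by
    rintro a b ⟨g, hg, rfl, rfl⟩
    by_contra hlt
    refine hclosed ?_
    have h1 := degree_head_le hmax hg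
    have h2 := degree_head_le hmax hg.reverse
    have h3 := hdeg (g 0)
    have h4 := hdeg (g (q - 1))
    obtain ⟨h, hh, hcl, -⟩ := hg.exists_closed hq2 (by
      have h5 : ((Finset.range q).filter fun i => G.Adj (g (q - 1 - 0)) (g (q - 1 - i))).card ≤
          ((Finset.range q).filter fun i => G.Adj (g (q - 1)) (g i)).card := by
        refine Finset.card_le_card_of_injOn (fun i => q - 1 - i) (fun i hi => ?_)
          (fun i hi j hj hij => ?_)
        · simp only [Finset.coe_filter, Finset.mem_range, Set.mem_ofPred_eq] at hi ⊢
          exact ⟨by omega, hi.2⟩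
        · simp only [Finset.coe_filter, Finset.mem_range, Set.mem_ofPred_eq] at hi hj hij
          omega
      rw [Nat.sub_zero] at h2 h5
      omega)
    exact ⟨h, hq2, hh, hcl⟩
  have hdich := ends_dichotomy hk hpk hkp hcard hdeg hsum hno hq1 hmax hopen
  -- a longest path with a light end has its other end at the unique heavy vertex
  have hlight : ∀ a, c a ≤ 1 → ∀ b, Ends G q a b → p + 1 ≤ c b := by
    intro a ha b hab
    rcases hdich a with ⟨b', hb', hcb'⟩ | h
    · have := hopen _ _ hb'
      omega
    · exact h b hab.symm
  have hheavy : ∀ a b, Ends G q a b → p + 1 ≤ c a ∨ p + 1 ≤ c b := by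
    intro a b hab
    rcases hdich b with ⟨a', ha', hca'⟩ | h
    · exact Or.inr (hlight a' hca' b ha')
    · exact Or.inl (h a hab)
  have hne_ends : ∀ a b, Ends G q a b → a ≠ b := by
    rintro a b ⟨g, hg, rfl, rfl⟩ h
    have := hg.1 _ _ (by omega) (by omega) h
    omega
  obtain ⟨a, r, har, hca⟩ : ∃ a r, Ends G q a r ∧ c a ≤ 1 := by
    have h0 : Ends G q (f 0) (f (q - 1)) := ⟨f, hf, rfl, rfl⟩
    rcases hdich (f (q - 1)) with ⟨a, ha, hca⟩ | h
    · exact ⟨a, _, ha, hca⟩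
    · rcases hdich (f 0) with ⟨b, hb, hcb⟩ | h'
      · exact ⟨b, _, hb, hcb⟩
      · exact absurd (huniq _ _ (h _ h0) (h' _ h0.symm)) (hne_ends _ _ h0)
  have hcr := hlight a hca r har
  have hpart : ∀ b, Ends G q a b → b = r := fun b hb => huniq _ _ (hlight a hca b hb) hcr
  obtain ⟨g, hg, rfl, rfl⟩ := har
  -- the only neighbour of the heavy end is its predecessor on the path
  have hpend : ∀ i < q, G.Adj (g (q - 1)) (g i) → i = q - 2 := by
    intro i hi hadj
    have hne : i ≠ q - 1 := by
      rintro rfl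
      exact hadj.ne rfl
    have h1 := hg.reverse.rotate (i := q - 1 - i) (by omega) (by
      rw [Nat.sub_zero, show q - 1 - (q - 1 - i) = i by omega]
      exact hadj)
    have h2 : Ends G q (g 0) (g (i + 1)) := by
      refine Ends.symm ⟨_, h1, ?_, ?_⟩
      · rw [if_pos (by omega)]
        congr 1
        omega
      · rw [if_neg (by omega)]
        congr 1
        omega
    have := hg.1 _ _ (by omega) (by omega) (hpart _ h2)
    omega
  have hmemr : ∀ w, G.Adj (g (q - 1)) w → w = g (q - 2) := by
    intro w hw
    obtain ⟨i, hi, rfl⟩ := mem_of_adj_head hmax hg.reverse (w := w)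
      (by rwa [Nat.sub_zero])
    have := hpend (q - 1 - i) (by omega) (by simpa using hw)
    rw [this]
  have hdegr : G.degree (g (q - 1)) ≤ 1 := by
    rw [← G.card_neighborFinset_eq_degree, Finset.card_le_one]
    intro x hx y hy
    rw [mem_neighborFinset] at hx hy
    rw [hmemr x hx, hmemr y hy]
  have hckr : k ≤ c (g (q - 1)) := by
    have := hdeg (g (q - 1))
    omega
  have hcprev : c (g (q - 2)) + c (g (q - 1)) ≤ 2 * p := by
    have := hsum 2 _ (by omega) (hg.sub (t := 2) (q - 2) (by omega))
    rw [Finset.sum_range_succ, Finset.sum_range_one] at this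
    rwa [add_zero, show q - 2 + 1 = q - 1 by omega] at this
  have hd0 := hdeg (g 0)
  have hN0 : G.degree (g 0) ≤ ((Finset.range (q - 1)).filter fun i => G.Adj (g 0) (g i)).card := by
    refine (degree_head_le hmax hg).trans (Finset.card_le_card fun i hi => ?_)
    simp only [Finset.mem_filter, Finset.mem_range] at hi ⊢
    refine ⟨?_, hi.2⟩
    have : i ≠ q - 1 := by
      rintro rfl
      exact hclosed ⟨g, hq2, hg, hi.2.symm⟩
    omega
  have hq3 : k + 1 ≤ q := by
    have h1 := Finset.card_filter_le (Finset.range (q - 1)) fun i => G.Adj (g 0) (g i)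
    rw [Finset.card_range] at h1
    omega
  have hN1 : G.degree (g (q - 2)) ≤
      ((Finset.range (q - 1)).filter fun i => G.Adj (g (q - 2)) (g i)).card + 1 := by
    rw [← G.card_neighborFinset_eq_degree]
    have hsub : G.neighborFinset (g (q - 2)) ⊆ insert (g (q - 1))
        (((Finset.range (q - 1)).filter fun i => G.Adj (g (q - 2)) (g i)).image g) := by
      intro w hw
      rw [mem_neighborFinset] at hw
      rw [Finset.mem_insert, Finset.mem_image]
      by_contra! hcon
      -- replacing the heavy end by `w` gives another longest path with a light end
      have hw' : ∀ i < q - 1, w ≠ g i := by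
        rintro i hi rfl
        exact hcon.2 i (by simp [hi, hw]) rfl
      have h1 := (hg.take (t := q - 1) (by omega)).append (IsPathFun.single (G := G) w) (by omega)
        (fun i j hi _ h => hw' i hi h.symm) (by
          rw [show q - 1 - 1 = q - 2 by omega]
          exact hw)
      rw [show q - 1 + 1 = q by omega] at h1
      refine hcon.1 (hpart w ⟨_, h1, ?_, ?_⟩)
      · rw [if_pos (by omega)]
      · rw [if_neg (by omega)]
    exact (Finset.card_le_card hsub).trans ((Finset.card_insert_le _ _).trans
      (Nat.add_le_add_right Finset.card_image_le _))
  have hd1 := hdeg (g (q - 2))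
  have hg' := hg.take (t := q - 1) (by omega)
  obtain ⟨h, hh, hcl, hsub⟩ := hg'.exists_closed (by omega) (by
    rw [show q - 1 - 1 = q - 2 by omega]
    omega)
  have himg := image_eq_of_closed hg' hh hsub
  set K := (Finset.range (q - 1)).image g
  have hrK : g (q - 1) ∉ K := by
    intro hmem
    obtain ⟨i, hi, hii⟩ := Finset.mem_image.mp hmem
    have h1 := Finset.mem_range.mp hi
    have := hg.1 _ _ (by omega) (by omega) hii
    omega
  have hout : ∀ u ∈ K, ∀ w ∉ K, G.Adj u w → w = g (q - 1) := by
    intro u hu w hw huw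
    rw [← himg] at hu
    obtain ⟨j, hj, rfl⟩ := Finset.mem_image.mp hu
    have hj' := Finset.mem_range.mp hj
    have hK : ∀ i < q - 1, h i ∈ K := fun i hi => by
      rw [← himg]
      exact Finset.mem_image_of_mem _ (Finset.mem_range.mpr hi)
    have h1 := (IsPathFun.single (G := G) w).append (hh.cyclicShift hcl j) (by omega)
      (fun i i' _ hi' hwi => hw (by
        rw [hwi]
        exact hK _ (Nat.mod_lt _ (by omega)))) (by
        rw [add_zero, Nat.mod_eq_of_lt hj']
        exact huw.symm)
    rw [show 1 + (q - 1) = q by omega] at h1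
    have hend : Ends G q w (h ((j + (q - 1 - 1)) % (q - 1))) := ⟨_, h1, by simp, by
      rw [if_neg (by omega)]⟩
    rcases hheavy _ _ hend with h2 | h2
    · exact huniq _ _ h2 hcr
    · have h3 := huniq _ _ h2 hcr
      have h4 := hK ((j + (q - 1 - 1)) % (q - 1)) (Nat.mod_lt _ (by omega))
      rw [h3] at h4
      exact absurd h4 hrK
  refine ⟨K, ?_, ?_⟩
  · rw [Finset.card_image_of_injOn, Finset.card_range]
    · omega
    · intro i hi j hj hij
      exact hg'.1 i j (by simpa using hi) (by simpa using hj) hij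
  · have hcut : ∑ i ∈ Finset.range (q - 1),
        (Finset.univ.filter fun w => w ∉ K ∧ G.Adj (g i) w).card ≤ 1 := by
      have : ∀ i ∈ Finset.range (q - 1), (Finset.univ.filter fun w => w ∉ K ∧ G.Adj (g i) w).card ≤
          if i = q - 2 then 1 else 0 := by
        intro i hi
        have hi' := Finset.mem_range.mp hi
        have hsub : (Finset.univ.filter fun w => w ∉ K ∧ G.Adj (g i) w) ⊆
            if i = q - 2 then {g (q - 1)} else ∅ := by
          intro w hw
          simp only [Finset.mem_filter, Finset.mem_univ, true_and] at hw
          have h1 := hout _ (Finset.mem_image_of_mem _ hi) w hw.1 hw.2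
          have h2 := hpend i (by omega) (by rw [← h1]; exact hw.2.symm)
          rw [if_pos h2, h1]
          exact Finset.mem_singleton_self _
        refine (Finset.card_le_card hsub).trans ?_
        split_ifs <;> simp
      refine (Finset.sum_le_sum this).trans ?_
      rw [Finset.sum_ite_eq' _ _ fun _ => 1]
      split_ifs <;> simp
    rw [sum_image_path hg', Finset.sum_add_distrib]
    have hq : q - 1 + 1 = q := by omega
    rcases le_or_gt q (k + p) with hle | hlt
    · have h1 := hsum q g hle hg
      rw [← hq, Finset.sum_range_succ] at h1
      omega
    · -- the first and the last `k + p` vertices cover the path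
      have h1 := hsum (k + p) g le_rfl (hg.take (by omega))
      have h2 := hsum (k + p) _ le_rfl (hg.sub (t := k + p) (q - (k + p)) (by omega))
      have h3 : ∑ i ∈ Finset.range q, c (g i) ≤ ∑ i ∈ Finset.range (k + p), c (g i) +
          ∑ i ∈ Finset.range (k + p), c (g (q - (k + p) + i)) := by
        have h4 := Finset.sum_range_add_sum_Ico (fun i => c (g i)) (show k + p ≤ q by omega)
        have h5 : ∑ i ∈ Finset.Ico (k + p) q, c (g i) ≤
            ∑ i ∈ Finset.Ico (q - (k + p)) q, c (g i) :=
          Finset.sum_le_sum_of_subset (Finset.Ico_subset_Ico (by omega) le_rfl)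
        rw [Finset.sum_Ico_eq_sum_range _ (q - (k + p)),
          show q - (q - (k + p)) = k + p by omega] at h5
        omega
      rw [← hq, Finset.sum_range_succ, hq] at h3
      omega

end Weighted

/-! ### Sparse cuts in graphs on `3 * k` vertices -/

theorem IsPathFun.map {V W : Type*} {G : SimpleGraph V} {G' : SimpleGraph W} {s : ℕ} {f : ℕ → V}
    (hf : IsPathFun G s f) (φ : V → W) (hφ : Function.Injective φ)
    (hadj : ∀ a b, G.Adj a b → G'.Adj (φ a) (φ b)) : IsPathFun G' s (fun i => φ (f i)) :=
  ⟨fun i j hi hj h => hf.1 i j hi hj (hφ h), fun i hi => hadj _ _ (hf.2 i hi)⟩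

/-- The key inequality. Let `f` be a cycle with `2 * p` vertices in a graph without longer even
cycles up to length `2 * k`. If `r i` is adjacent to `f a` and `r j` to `f b`, where `i < j`, then
`a + i` and `b + j` differ modulo `2 * p`: otherwise an arc of the cycle and the segment of `r`
from `r i` to `r j` form an even cycle that is too long. Hence the neighbourhoods on the cycle of
the vertices of a path disjoint from it become disjoint after translation. -/
theorem sum_card_adj_cycle_le {V : Type*} {G : SimpleGraph V} [DecidableRel G.Adj] {k p s : ℕ}
    (hpk : p < k) (hkp : k ≤ 2 * p)
    (hno : ∀ m, Even m → 2 * p + 2 ≤ m → m ≤ 2 * k → ¬ HasCycle G m) {f r : ℕ → V}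
    (hf : IsPathFun G (2 * p) f) (hcl : G.Adj (f (2 * p - 1)) (f 0)) (hr : IsPathFun G s r)
    (hs : s ≤ k + p) (hd : ∀ i j, i < s → j < 2 * p → r i ≠ f j) :
    ∑ i ∈ Finset.range s, ((Finset.range (2 * p)).filter fun a => G.Adj (r i) (f a)).card ≤
      2 * p := by
  classical
  have hlt : ∀ a, a % (2 * p) < 2 * p := fun a => Nat.mod_lt _ (by omega)
  have key : ∀ i j a b, i < j → j < s → a < 2 * p → b < 2 * p → G.Adj (r i) (f a) →
      G.Adj (r j) (f b) → (a + i) % (2 * p) ≠ (b + j) % (2 * p) := by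
    intro i j a b hij hjs ha hb hia hjb hmod
    obtain ⟨d, rfl⟩ : ∃ d, j = i + d := ⟨j - i, by omega⟩
    have hab : a ≡ b + d [MOD 2 * p] := by
      refine Nat.ModEq.add_right_cancel' i ?_
      rw [add_assoc, add_comm d i]
      exact hmod
    rcases Nat.lt_or_ge (2 * p) d with hd' | hd'
    · obtain ⟨e, rfl⟩ : ∃ e, d = 2 * p + e := ⟨d - 2 * p, by omega⟩
      have hend : (b + e) % (2 * p) = a := by
        have h1 : b + e ≡ a [MOD 2 * p] := by
          refine Nat.ModEq.trans ?_ hab.symm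
          rw [show b + (2 * p + e) = b + e + 2 * p by ring]
          exact (Nat.ModEq.add_right_cancel' (2 * p) (by simp [Nat.ModEq]))
        rw [Nat.ModEq, Nat.mod_eq_of_lt ha] at h1
        exact h1
      refine hno (e + 1 + (2 * p + e + 1)) ?_ (by omega) (by omega)
        (((hf.cyclicShift hcl b).take (t := e + 1) (by omega)).hasCycle_join
          (hr.sub (t := 2 * p + e + 1) i (by omega)) (by omega) (by omega) (by omega)
          (fun x y hx hy h => hd _ _ (by omega) (hlt _) h.symm) ?_ ?_)
      · rw [Nat.even_iff]; omega
      · rw [Nat.add_sub_cancel, hend]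
        exact hia.symm
      · rw [Nat.add_sub_cancel, add_zero, Nat.mod_eq_of_lt hb]
        exact hjb
    · have hend : (a + (2 * p - d)) % (2 * p) = b := by
        have h1 : a + (2 * p - d) ≡ b [MOD 2 * p] := by
          refine (hab.add_right _).trans ?_
          rw [add_assoc, show d + (2 * p - d) = 2 * p by omega]
          simp [Nat.ModEq]
        rw [Nat.ModEq, Nat.mod_eq_of_lt hb] at h1
        exact h1
      refine hno (2 * p - d + 1 + (d + 1)) ?_ (by omega) (by omega)
        (((hf.cyclicShift hcl a).take (t := 2 * p - d + 1) (by omega)).hasCycle_join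
          (hr.sub (t := d + 1) i (by omega)).reverse (by omega) (by omega) (by omega)
          (fun x y hx hy h => hd _ _ (by omega) (hlt _) h.symm) ?_ ?_)
      · rw [Nat.even_iff]; omega
      · rw [Nat.add_sub_cancel, hend, Nat.add_sub_cancel, Nat.sub_zero]
        exact hjb.symm
      · rw [Nat.add_sub_cancel, Nat.sub_self, add_zero, add_zero, Nat.mod_eq_of_lt ha]
        exact hia
  have hcard : ∀ i ∈ Finset.range s,
      ((Finset.range (2 * p)).filter fun a => G.Adj (r i) (f a)).card =
      (((Finset.range (2 * p)).filter fun a => G.Adj (r i) (f a)).image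
        fun a => (a + i) % (2 * p)).card := by
    intro i _
    refine (Finset.card_image_of_injOn fun a ha b hb hab => ?_).symm
    have ha' := (Finset.mem_filter.mp ha).1
    have hb' := (Finset.mem_filter.mp hb).1
    rw [Finset.mem_range] at ha' hb'
    have h1 : a ≡ b [MOD 2 * p] := Nat.ModEq.add_right_cancel' i hab
    rwa [Nat.ModEq, Nat.mod_eq_of_lt ha', Nat.mod_eq_of_lt hb'] at h1
  rw [Finset.sum_congr rfl hcard, ← Finset.card_biUnion]
  · refine (Finset.card_le_card (t := Finset.range (2 * p)) fun x hx => ?_).trans (by simp)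
    simp only [Finset.mem_biUnion, Finset.mem_image] at hx
    obtain ⟨i, _, a, _, rfl⟩ := hx
    exact Finset.mem_range.mpr (hlt _)
  · intro i hi j hj hij
    simp only [Function.onFun]
    rw [Finset.disjoint_left]
    intro x hx hx'
    obtain ⟨a, ha, rfl⟩ := Finset.mem_image.mp hx
    obtain ⟨b, hb, hab⟩ := Finset.mem_image.mp hx'
    simp only [Finset.mem_filter, Finset.mem_range, Finset.coe_range, Set.mem_Iio] at ha hb hi hj
    rcases Nat.lt_or_gt_of_ne hij with h | h
    · exact key i j a b h hj ha.1 hb.1 ha.2 hb.2 hab.symm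
    · exact key j i b a h hi hb.1 ha.1 hb.2 ha.2 hab

/-- A vertex adjacent to more than half of the vertices of a cycle with `2 * p` vertices is adjacent
to both ends of at least two edges of the cycle. -/
theorem two_le_card_insertions {V : Type*} {G : SimpleGraph V} [DecidableRel G.Adj] {p : ℕ}
    (hp : 0 < p) (f : ℕ → V) (r : V)
    (hr : p + 1 ≤ ((Finset.range (2 * p)).filter fun a => G.Adj r (f a)).card) :
    2 ≤ ((Finset.range (2 * p)).filter fun a =>
      G.Adj r (f a) ∧ G.Adj r (f ((a + 1) % (2 * p)))).card := by
  classical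
  set D := (Finset.range (2 * p)).filter fun a => G.Adj r (f a)
  set D' := (Finset.range (2 * p)).filter fun a => G.Adj r (f ((a + 1) % (2 * p)))
  have hD' : D.card ≤ D'.card := by
    refine Finset.card_le_card_of_injOn (fun a => (a + (2 * p - 1)) % (2 * p)) (fun a ha => ?_)
      (fun a ha b hb hab => ?_)
    · simp only [D, D', Finset.coe_filter, Finset.mem_range, Set.mem_ofPred_eq] at ha ⊢
      refine ⟨Nat.mod_lt _ (by omega), ?_⟩
      rw [Nat.mod_add_mod, show a + (2 * p - 1) + 1 = a + 2 * p by omega, Nat.add_mod_right,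
        Nat.mod_eq_of_lt ha.1]
      exact ha.2
    · simp only [D, Finset.coe_filter, Finset.mem_range, Set.mem_ofPred_eq] at ha hb
      have h1 : a ≡ b [MOD 2 * p] := Nat.ModEq.add_right_cancel' _ hab
      rwa [Nat.ModEq, Nat.mod_eq_of_lt ha.1, Nat.mod_eq_of_lt hb.1] at h1
  have h1 := Finset.card_union_add_card_inter D D'
  have h2 : (D ∪ D').card ≤ 2 * p := by
    have := Finset.card_le_card (Finset.union_subset (Finset.filter_subset _ _ : D ⊆ _)
      (Finset.filter_subset _ _ : D' ⊆ _))
    simpa using this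
  have h3 : D ∩ D' = (Finset.range (2 * p)).filter fun a =>
      G.Adj r (f a) ∧ G.Adj r (f ((a + 1) % (2 * p))) := by
    ext a
    simp only [D, D', Finset.mem_inter, Finset.mem_filter]
    tauto
  rw [← h3]
  omega

/-- Two vertices off a cycle can be inserted into two different edges of it. -/
theorem hasCycle_of_two_insertions {V : Type*} {G : SimpleGraph V} {l : ℕ} (hl : 2 ≤ l)
    {f : ℕ → V} (hf : IsPathFun G l f) (hcl : G.Adj (f (l - 1)) (f 0)) {r r' : V} (hrr : r ≠ r')
    (hr : ∀ i < l, r ≠ f i) (hr' : ∀ i < l, r' ≠ f i) {a a' : ℕ} (haa : a < a') (ha' : a' < l)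
    (h1 : G.Adj r (f a)) (h2 : G.Adj r (f ((a + 1) % l)))
    (h3 : G.Adj r' (f a')) (h4 : G.Adj r' (f ((a' + 1) % l))) : HasCycle G (l + 2) := by
  have hlt : ∀ a, a % l < l := fun a => Nat.mod_lt _ (by omega)
  have hy := hf.cyclicShift hcl (a + 1)
  have hA := (hy.take (t := a' - a) (by omega)).append (IsPathFun.single (G := G) r') (by omega)
    (fun i j _ _ h => hr' _ (hlt _) h.symm) (by
      rw [show a + 1 + (a' - a - 1) = a' by omega, Nat.mod_eq_of_lt ha']
      exact h3.symm)
  have hB := (hy.sub (t := l - (a' - a)) (a' - a) (by omega)).append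
    (IsPathFun.single (G := G) r) (by omega) (fun i j _ _ h => hr _ (hlt _) h.symm) (by
      rw [show a + 1 + (a' - a + (l - (a' - a) - 1)) = a + l by omega, Nat.add_mod_right,
        Nat.mod_eq_of_lt (by omega)]
      exact h1.symm)
  have := hA.hasCycle_join hB (by omega) (by omega) (by omega) (fun i j hi hj h => ?_) ?_ ?_
  · rwa [show a' - a + 1 + (l - (a' - a) + 1) = l + 2 by omega] at this
  · split_ifs at h with h5 h6 h6
    · have := hy.1 _ _ (by omega) (by omega) h
      omega
    · exact hr _ (hlt _) h.symm
    · exact hr' _ (hlt _) h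
    · exact hrr h.symm
  · rw [if_neg (by omega), if_pos (by omega), show a + 1 + (a' - a + 0) = a' + 1 by omega]
    exact h4
  · rw [if_neg (by omega), if_pos (by omega), add_zero]
    exact h2

/-- The number of edges between `A` and `B`, for disjoint `A` and `B`. (In general it is the number
of ordered pairs of adjacent vertices in `A × B`.) -/
def edgesBetween {V : Type*} (G : SimpleGraph V) [DecidableRel G.Adj] (A B : Finset V) : ℕ :=
  ∑ u ∈ A, (B.filter fun w => G.Adj u w).card

theorem edgesBetween_comm {V : Type*} (G : SimpleGraph V) [DecidableRel G.Adj] (A B : Finset V) :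
    edgesBetween G A B = edgesBetween G B A := by
  have := Finset.sum_card_bipartiteAbove_eq_sum_card_bipartiteBelow (s := A) (t := B)
    (r := fun u w => G.Adj u w)
  simp only [Finset.bipartiteAbove, Finset.bipartiteBelow] at this
  rw [edgesBetween, edgesBetween, this]
  refine Finset.sum_congr rfl fun u _ => ?_
  congr 1
  ext w
  simp [G.adj_comm]

/-- A vertex with few neighbours across a sparse cut. -/
theorem exists_card_adj_le_one {V : Type*} {G : SimpleGraph V} [DecidableRel G.Adj] {k : ℕ}
    (hk : 1 ≤ k) {A B : Finset V} (hA : k ≤ A.card) (h : edgesBetween G A B ≤ 2 * k - 2) :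
    ∃ u ∈ A, (B.filter fun w => G.Adj u w).card ≤ 1 := by
  by_contra! hcon
  have := Finset.card_nsmul_le_sum A (fun u => (B.filter fun w => G.Adj u w).card) 2
    (fun u hu => hcon u hu)
  rw [smul_eq_mul] at this
  rw [edgesBetween] at h
  omega

/-- A graph on `3 * k` vertices with minimum degree at least `k + 1` and no cycle on `2 * k` vertices
has a sparse cut. Its side `B` is found outside a longest even cycle with fewer than `2 * k`
vertices, by weighting the remaining vertices by their numbers of neighbours on that cycle. -/
theorem exists_sparse_cut {V : Type*} [Fintype V] [DecidableEq V] {G : SimpleGraph V}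
    [DecidableRel G.Adj] {k : ℕ} (hk : 3 ≤ k) (hV : Fintype.card V = 3 * k)
    (hdeg : ∀ v, k + 1 ≤ G.degree v) (hcyc : ¬ HasCycle G (2 * k)) :
    ∃ B : Finset V, k + 1 ≤ B.card ∧ k + 1 ≤ Bᶜ.card ∧ edgesBetween G B Bᶜ ≤ 2 * k - 2 := by
  classical
  obtain ⟨p, hkp, hpk, ⟨-, f, hf, hcl⟩, hno⟩ : ∃ p, k ≤ 2 * p ∧ p < k ∧ HasCycle G (2 * p) ∧
      ∀ m, Even m → 2 * p + 2 ≤ m → m ≤ 2 * k → ¬ HasCycle G m := by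
    obtain ⟨m, ⟨p₀, rfl⟩, h1, h2, h3⟩ := exists_even_cycle hk hV hdeg
    obtain ⟨p, hp, hpmax⟩ := Finset.exists_max_image
      ((Finset.range (k + 1)).filter fun p => HasCycle G (2 * p)) id
      ⟨p₀, by simp only [Finset.mem_filter, Finset.mem_range]; exact ⟨by omega, by rwa [two_mul]⟩⟩
    simp only [Finset.mem_filter, Finset.mem_range, id] at hp hpmax
    refine ⟨p, ?_, ?_, hp.2, ?_⟩
    · have := hpmax p₀ ⟨by omega, by rwa [two_mul]⟩
      omega
    · have : p ≠ k := by
        rintro rfl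
        exact hcyc hp.2
      omega
    · rintro m ⟨j, rfl⟩ h4 h5 h6
      have := hpmax j ⟨by omega, by rwa [two_mul]⟩
      omega
  set C := (Finset.range (2 * p)).image f
  have hfC : ∀ j < 2 * p, f j ∈ C := fun j hj =>
    Finset.mem_image_of_mem _ (Finset.mem_range.mpr hj)
  have hCcard : C.card = 2 * p := by
    rw [Finset.card_image_of_injOn, Finset.card_range]
    intro i hi j hj hij
    exact hf.1 i j (by simpa using hi) (by simpa using hj) hij
  let R := {v : V // v ∉ C}
  let H : SimpleGraph R := G.comap Subtype.val
  let c : R → ℕ := fun r => ((Finset.range (2 * p)).filter fun a => G.Adj r.1 (f a)).card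
  have hne : ∀ (r : R) (j : ℕ), j < 2 * p → r.1 ≠ f j := fun r j hj h => r.2 (h ▸ hfC j hj)
  have hcycle : ∀ m, HasCycle H m → HasCycle G m := by
    rintro m ⟨h3, g, hg, hgc⟩
    exact ⟨h3, _, hg.map Subtype.val Subtype.val_injective (fun a b h => h), hgc⟩
  have hRcard : Fintype.card R + 2 * p = 3 * k := by
    have h1 : Fintype.card R = Fintype.card V - Fintype.card {v : V // v ∈ C} :=
      Fintype.card_subtype_compl _
    have h2 : Fintype.card {v : V // v ∈ C} = 2 * p := by rw [Fintype.card_coe, hCcard]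
    omega
  have hnbrC : ∀ u : R, (C.filter fun w => G.Adj u.1 w).card ≤ c u := by
    intro u
    refine (Finset.card_le_card (t := ((Finset.range (2 * p)).filter fun a =>
      G.Adj u.1 (f a)).image f) fun w hw => ?_).trans Finset.card_image_le
    obtain ⟨hwC, huw⟩ := Finset.mem_filter.mp hw
    obtain ⟨j, hj, rfl⟩ := Finset.mem_image.mp hwC
    exact Finset.mem_image_of_mem _ (Finset.mem_filter.mpr ⟨hj, huw⟩)
  have hRdeg : ∀ r, k + 1 ≤ H.degree r + c r := by
    intro r
    refine (hdeg r.1).trans ?_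
    rw [← G.card_neighborFinset_eq_degree, ← H.card_neighborFinset_eq_degree]
    have hsub : G.neighborFinset r.1 ⊆ (H.neighborFinset r).image Subtype.val ∪
        C.filter fun w => G.Adj r.1 w := by
      intro w hw
      rw [mem_neighborFinset] at hw
      rw [Finset.mem_union, Finset.mem_image, Finset.mem_filter]
      by_cases hwC : w ∈ C
      · exact Or.inr ⟨hwC, hw⟩
      · exact Or.inl ⟨⟨w, hwC⟩, by rw [mem_neighborFinset]; exact hw, rfl⟩
    exact (Finset.card_le_card hsub).trans ((Finset.card_union_le _ _).trans
      (Nat.add_le_add Finset.card_image_le (hnbrC r)))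
  obtain ⟨K, hK, hKsum⟩ := exists_sparse_cut_of_weights (G := H) (c := c) hk hpk hkp hRcard hRdeg
    (fun s g hs hg => sum_card_adj_cycle_le hpk hkp hno hf hcl
      (hg.map (G' := G) Subtype.val Subtype.val_injective (fun a b h => h)) hs
      (fun i j _ hj => hne _ j hj))
    (fun r r' h1 h2 => by
      by_contra hrr
      have h3 := two_le_card_insertions (by omega) f r.1 h1
      have h4 := two_le_card_insertions (by omega) f r'.1 h2
      obtain ⟨a, ha⟩ := Finset.card_pos.mp (by omega :
        0 < ((Finset.range (2 * p)).filter fun a =>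
          G.Adj r.1 (f a) ∧ G.Adj r.1 (f ((a + 1) % (2 * p)))).card)
      obtain ⟨a', ha', haa⟩ := Finset.exists_mem_ne (show 1 <
        ((Finset.range (2 * p)).filter fun a =>
          G.Adj r'.1 (f a) ∧ G.Adj r'.1 (f ((a + 1) % (2 * p)))).card by omega) a
      simp only [Finset.mem_filter, Finset.mem_range] at ha ha'
      have hrr' : r.1 ≠ r'.1 := fun h => hrr (Subtype.ext h)
      refine hno (2 * p + 2) ⟨p + 1, by ring⟩ le_rfl (by omega) ?_
      rcases Nat.lt_or_gt_of_ne haa with h | h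
      · exact hasCycle_of_two_insertions (by omega) hf hcl hrr'.symm (hne r') (hne r) h ha.1
          ha'.2.1 ha'.2.2 ha.2.1 ha.2.2
      · exact hasCycle_of_two_insertions (by omega) hf hcl hrr' (hne r) (hne r') h ha'.1
          ha.2.1 ha.2.2 ha'.2.1 ha'.2.2)
    (fun m h1 h2 h3 h4 => hno m h1 h2 h3 (hcycle m h4))
  set B := K.image Subtype.val
  have hBK : B.card = K.card := Finset.card_image_of_injective _ Subtype.val_injective
  have hmemB : ∀ r : R, r.1 ∈ B ↔ r ∈ K := fun r =>
    ⟨fun h => by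
      obtain ⟨r', hr', he⟩ := Finset.mem_image.mp h
      rwa [← Subtype.ext he], fun h => Finset.mem_image_of_mem _ h⟩
  have hcut : edgesBetween G B Bᶜ ≤ 2 * k - 2 := by
    refine le_trans ?_ hKsum
    rw [edgesBetween, Finset.sum_image fun _ _ _ _ h => Subtype.ext h]
    refine Finset.sum_le_sum fun u _ => ?_
    have hsub : (Bᶜ.filter fun w => G.Adj u.1 w) ⊆ (C.filter fun w => G.Adj u.1 w) ∪
        (Finset.univ.filter fun w => w ∉ K ∧ H.Adj u w).image Subtype.val := by
      intro w hw
      rw [Finset.mem_filter, Finset.mem_compl] at hw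
      rw [Finset.mem_union, Finset.mem_image, Finset.mem_filter]
      by_cases hwC : w ∈ C
      · exact Or.inl ⟨hwC, hw.2⟩
      · exact Or.inr ⟨⟨w, hwC⟩, by
          rw [Finset.mem_filter, ← hmemB]
          exact ⟨Finset.mem_univ _, hw.1, hw.2⟩, rfl⟩
    exact (Finset.card_le_card hsub).trans ((Finset.card_union_le _ _).trans
      (Nat.add_le_add (hnbrC u) Finset.card_image_le))
  have hCB : C ⊆ Bᶜ := by
    intro w hw
    rw [Finset.mem_compl]
    intro hwB
    obtain ⟨r, _, rfl⟩ := Finset.mem_image.mp hwB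
    exact r.2 hw
  have hCBc := Finset.card_le_card hCB
  -- a vertex with at most one neighbour on the other side has at least `k` on its own side
  have hside : ∀ A : Finset V, k ≤ A.card → edgesBetween G A Aᶜ ≤ 2 * k - 2 →
      k + 1 ≤ A.card := by
    intro A hA hE
    obtain ⟨u, hu, hu1⟩ := exists_card_adj_le_one (by omega) hA hE
    have h1 := hdeg u
    rw [← G.card_neighborFinset_eq_degree] at h1
    have h2 : G.neighborFinset u ⊆ A.erase u ∪ Aᶜ.filter fun w => G.Adj u w := by
      intro w hw
      rw [mem_neighborFinset] at hw
      by_cases hwA : w ∈ A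
      · exact Finset.mem_union_left _ (Finset.mem_erase.mpr ⟨hw.ne', hwA⟩)
      · exact Finset.mem_union_right _ (Finset.mem_filter.mpr ⟨Finset.mem_compl.mpr hwA, hw⟩)
    have h3 := (Finset.card_le_card h2).trans (Finset.card_union_le _ _)
    rw [Finset.card_erase_of_mem hu] at h3
    omega
  refine ⟨B, hside B (by omega) hcut, hside Bᶜ (by omega) ?_, hcut⟩
  rwa [compl_compl, edgesBetween_comm]

/-! ### Two crossing sparse cuts -/

/-- The sparse cut of `exists_sparse_cut`, for the subgraph induced by a set of `3 * k` vertices. -/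
theorem exists_sparse_cut_of_finset {V : Type*} [DecidableEq V] {G : SimpleGraph V}
    [DecidableRel G.Adj] {k : ℕ} (hk : 3 ≤ k) {H : Finset V} (hH : H.card = 3 * k)
    (hdeg : ∀ v ∈ H, k + 1 ≤ (H.filter fun w => G.Adj v w).card)
    (hcyc : ¬ ∃ f, IsPathFun G (2 * k) f ∧ G.Adj (f (2 * k - 1)) (f 0) ∧ ∀ i, f i ∈ H) :
    ∃ A B : Finset V, A ∪ B = H ∧ Disjoint A B ∧ k + 1 ≤ A.card ∧ k + 1 ≤ B.card ∧
      edgesBetween G A B ≤ 2 * k - 2 := by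
  classical
  obtain ⟨K, h1, h2, h3⟩ := exists_sparse_cut (V := {v // v ∈ H})
    (G := G.comap Subtype.val) hk (by rw [Fintype.card_coe, hH])
    (fun v => by
      refine (hdeg v v.2).trans ?_
      rw [← card_neighborFinset_eq_degree, ← Finset.card_image_of_injective _
        (Subtype.val_injective (p := fun v => v ∈ H))]
      refine Finset.card_le_card fun w hw => ?_
      rw [Finset.mem_filter] at hw
      exact Finset.mem_image.mpr ⟨⟨w, hw.1⟩, by rw [mem_neighborFinset]; exact hw.2, rfl⟩)
    (by
      rintro ⟨-, f, hf, hcl⟩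
      exact hcyc ⟨fun i => (f i).1, hf.map (G' := G) Subtype.val Subtype.val_injective
        (fun a b h => h), hcl, fun i => (f i).2⟩)
  have hinj := Subtype.val_injective (p := fun v => v ∈ H)
  refine ⟨K.image Subtype.val, Kᶜ.image Subtype.val, ?_, ?_, ?_, ?_, ?_⟩
  · rw [← Finset.image_union, Finset.union_compl]
    ext w
    simp
  · rw [Finset.disjoint_image hinj]
    exact disjoint_compl_right
  · rwa [Finset.card_image_of_injective _ hinj]
  · rwa [Finset.card_image_of_injective _ hinj]
  · refine le_of_eq_of_le ?_ h3
    rw [edgesBetween, edgesBetween, Finset.sum_image fun _ _ _ _ h => hinj h]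
    refine Finset.sum_congr rfl fun u _ => ?_
    rw [Finset.filter_image, Finset.card_image_of_injective _ hinj]
    rfl

/-- For a cut `(A, B)` and subsets `I ⊆ A`, `J ⊆ B`, only the edges between `I` and `J` are counted
twice when the edges of the cut at `I` and at `J` are added up. -/
theorem edgesBetween_add_edgesBetween_le {V : Type*} [DecidableEq V] (G : SimpleGraph V)
    [DecidableRel G.Adj] {A B I J : Finset V} (hI : I ⊆ A) (hJ : J ⊆ B) :
    edgesBetween G I B + edgesBetween G J A ≤ edgesBetween G A B + I.card * J.card := by
  have h1 : edgesBetween G A B = edgesBetween G (A \ I) B + edgesBetween G I B :=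
    (Finset.sum_sdiff hI).symm
  have h2 : edgesBetween G J A ≤ edgesBetween G J (A \ I) + J.card * I.card := by
    rw [edgesBetween, edgesBetween, ← smul_eq_mul J.card, ← Finset.sum_const,
      ← Finset.sum_add_distrib]
    refine Finset.sum_le_sum fun u _ => ?_
    nth_rw 1 [← Finset.sdiff_union_of_subset hI]
    rw [Finset.filter_union]
    exact (Finset.card_union_le _ _).trans
      (Nat.add_le_add_left (Finset.card_filter_le _ _) _)
  have h3 : edgesBetween G J (A \ I) ≤ edgesBetween G (A \ I) B := by
    rw [edgesBetween_comm G (A \ I)]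
    exact Finset.sum_le_sum_of_subset hJ
  rw [mul_comm] at h2
  omega

theorem edgesBetween_mono_left {V : Type*} (G : SimpleGraph V) [DecidableRel G.Adj]
    {A B I : Finset V} (hI : I ⊆ A) :
    edgesBetween G I B ≤ edgesBetween G A B :=
  Finset.sum_le_sum_of_subset hI

/-- The numerical contradiction between two crossing sparse cuts: `b` is the size of the far side
of the first cut, `a₂` and `b₂` are the sizes of the two sides of the second one, and `i + j`
vertices are split by the second cut into `i` and `j`. -/
theorem crossing_cuts_arith {k i j a₂ b₂ b X Y Z : ℕ} (hk : 3 ≤ k) (hij : i + j = k)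
    (ha₂ : k + 1 ≤ a₂) (hb₂ : k + 1 ≤ b₂) (hab : a₂ + b₂ = 3 * k) (hb : 3 * k ≤ 2 * b)
    (hZ : Z ≤ 2 * k - 2) (hX : X ≤ 2 * k - 2) (hY : Y ≤ 2 * k - 2)
    (hXY : X + Y ≤ 2 * k - 2 + i * j)
    (h : i * (b + b₂) + j * (b + a₂) ≤ Z + X + Y + k * (2 * k - 1)) : False := by
  -- with `b₂ = k + 1 + y` and `a₂ = k + 1 + z`, the left side of `h` exceeds a multiple of `k` by
  -- `i * y + j * z`; the bound on `X + Y` is the useful one when `i ≤ 1` or `j ≤ 1`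
  obtain ⟨y, rfl⟩ := Nat.exists_eq_add_of_le hb₂
  obtain ⟨z, rfl⟩ := Nat.exists_eq_add_of_le ha₂
  obtain ⟨k, rfl⟩ := Nat.exists_eq_add_of_le hk
  have hz : z + y = k + 1 := by omega
  rw [show 2 * (3 + k) - 2 = 2 * k + 4 by omega] at *
  rw [show 2 * (3 + k) - 1 = 2 * k + 5 by omega] at h
  have hbk : (3 + k) * (3 * (3 + k)) ≤ (3 + k) * (2 * b) := Nat.mul_le_mul_left _ hb
  have e : i * (b + (3 + k + 1 + y)) + j * (b + (3 + k + 1 + z)) =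
      (3 + k) * b + (3 + k) * (k + 4) + (i * y + j * z) := by
    rw [← hij]
    have : k + 4 = i + j + 1 := by omega
    rw [this]; ring
  rw [e] at h
  rcases Nat.lt_or_ge i 2 with hi | hi
  · interval_cases i
    · nlinarith
    · obtain rfl : j = k + 2 := by omega
      nlinarith
  rcases Nat.lt_or_ge j 2 with hj | hj
  · interval_cases j
    · nlinarith
    · obtain rfl : i = k + 2 := by omega
      nlinarith
  have h1 : 2 * y ≤ i * y := Nat.mul_le_mul_right _ hi
  have h2 : 2 * z ≤ j * z := Nat.mul_le_mul_right _ hj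
  nlinarith

/-- If every vertex misses at most `2 * k - 2` others, then among `5 * k - 1` vertices some vertex
is joined to all vertices of a cycle with `2 * k` vertices. Otherwise, a sparse cut `(A, B)` of a
neighbourhood with `B` the larger side gives a vertex `h ∈ A` with at most one neighbour in `B`,
hence with at least `k` neighbours in `A`. These lie in a second sparse cut, of the neighbourhood
of `h`, and each of them has almost no neighbours in `B` nor on its far side of the second cut:
too many missing neighbours. -/
theorem exists_cycle_in_neighborhood {V : Type*} [Fintype V] [DecidableEq V] {G : SimpleGraph V}
    [DecidableRel G.Adj] {k : ℕ} (hk : 3 ≤ k) (hV : Fintype.card V = 5 * k - 1)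
    (hmiss : ∀ v, ∀ S : Finset V, v ∉ S → (S.filter fun w => ¬ G.Adj v w).card ≤ 2 * k - 2) :
    ∃ v f, IsPathFun G (2 * k) f ∧ G.Adj (f (2 * k - 1)) (f 0) ∧ ∀ i, G.Adj v (f i) := by
  by_contra hno
  have hcount : ∀ v, ∀ S : Finset V, v ∉ S →
      S.card ≤ (S.filter fun w => G.Adj v w).card + (2 * k - 2) := fun v S hS => by
    rw [← Finset.card_filter_add_card_filter_not (s := S) fun w => G.Adj v w]
    exact Nat.add_le_add_left (hmiss v S hS) _
  have hnbr : ∀ v, 3 * k ≤ (G.neighborFinset v).card := fun v => by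
    have h1 := hcount v (Finset.univ.erase v) (Finset.notMem_erase _ _)
    rw [Finset.card_erase_of_mem (Finset.mem_univ _), Finset.card_univ, hV] at h1
    have h2 : ((Finset.univ.erase v).filter fun w => G.Adj v w).card ≤
        (G.neighborFinset v).card := Finset.card_le_card fun w hw => by
      rw [mem_neighborFinset]
      exact (Finset.mem_filter.mp hw).2
    omega
  have hcut : ∀ v, ∀ H ⊆ G.neighborFinset v, H.card = 3 * k →
      ∃ A B : Finset V, A ∪ B = H ∧ Disjoint A B ∧ k + 1 ≤ A.card ∧ k + 1 ≤ B.card ∧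
      edgesBetween G A B ≤ 2 * k - 2 := fun v H hHv hH => by
    refine exists_sparse_cut_of_finset hk hH (fun u hu => ?_) ?_
    · have h1 := hcount u (H.erase u) (Finset.notMem_erase _ _)
      rw [Finset.card_erase_of_mem hu] at h1
      have h2 : ((H.erase u).filter fun w => G.Adj u w).card ≤
        (H.filter fun w => G.Adj u w).card :=
        Finset.card_le_card (Finset.filter_subset_filter _ (Finset.erase_subset _ _))
      omega
    · rintro ⟨f, hf, hcl, hfH⟩
      exact hno ⟨v, f, hf, hcl, fun i => (G.mem_neighborFinset v _).mp (hHv (hfH i))⟩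
  obtain ⟨v⟩ : Nonempty V := Fintype.card_pos_iff.mp (by omega)
  -- by symmetry, `B` is the larger side of the first cut
  obtain ⟨A, B, hBbig, hdisj, hA, hE⟩ : ∃ A B : Finset V, 3 * k ≤ 2 * B.card ∧ Disjoint A B ∧
      A.card + B.card = 3 * k ∧ k + 1 ≤ A.card ∧ edgesBetween G A B ≤ 2 * k - 2 := by
    obtain ⟨H, hHv, hH⟩ := Finset.exists_subset_card_eq (hnbr v)
    obtain ⟨A, B, hAB, hdisj, hA, hB, hE⟩ := hcut v H hHv hH
    have hc := Finset.card_union_of_disjoint hdisj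
    rw [hAB, hH] at hc
    rcases Nat.le_total A.card B.card with h | h
    · exact ⟨A, B, by omega, hdisj, hc.symm, hA, hE⟩
    · exact ⟨B, A, by omega, hdisj.symm, by omega, hB, by rwa [edgesBetween_comm]⟩
  obtain ⟨hA1, hE⟩ := hE
  obtain ⟨h, hhA, hhB⟩ := exists_card_adj_le_one (by omega) (by omega : k ≤ A.card) hE
  have hAh : k ≤ (A.filter fun w => G.Adj h w).card := by
    have h1 := hcount h ((A ∪ B).erase h) (Finset.notMem_erase _ _)
    rw [Finset.card_erase_of_mem (Finset.mem_union_left _ hhA),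
      Finset.card_union_of_disjoint hdisj] at h1
    have h2 : (((A ∪ B).erase h).filter fun w => G.Adj h w).card ≤
        (A.filter fun w => G.Adj h w).card + (B.filter fun w => G.Adj h w).card := by
      refine le_trans (Finset.card_le_card ?_) (Finset.card_union_le _ _)
      rw [← Finset.filter_union]
      exact Finset.filter_subset_filter _ (Finset.erase_subset _ _)
    omega
  obtain ⟨A₀, hA₀, hA₀k⟩ := Finset.exists_subset_card_eq hAh
  obtain ⟨H', hA₀H', hH'h, hH'⟩ := Finset.exists_subsuperset_card_eq
    (s := A₀) (t := G.neighborFinset h) (n := 3 * k)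
    (fun w hw => (G.mem_neighborFinset h w).mpr (Finset.mem_filter.mp (hA₀ hw)).2)
    (by omega) (hnbr h)
  obtain ⟨A₂, B₂, hAB₂, hdisj₂, hA₂, hB₂, hE₂⟩ := hcut h H' hH'h hH'
  have hc₂ := Finset.card_union_of_disjoint hdisj₂
  rw [hAB₂, hH'] at hc₂
  have hA₀A : A₀ ⊆ A := hA₀.trans (Finset.filter_subset _ _)
  -- `u ∈ A₀` misses at most `2 * k - 2` vertices of `B ∪ S`, and `B` and `S` share at most one
  -- vertex, because `S` consists of neighbours of `h`
  have hfar : ∀ S ⊆ H', ∀ u ∈ A₀, u ∉ S → B.card + S.card ≤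
      (B.filter fun w => G.Adj u w).card + (S.filter fun w => G.Adj u w).card + (2 * k - 1) := by
    intro S hS u hu huS
    have huB : u ∉ B := Finset.disjoint_left.mp hdisj (hA₀A hu)
    have h1 := hcount u (B ∪ S) (by simp [huB, huS])
    have h2 : (B ∩ S).card ≤ 1 := le_trans (Finset.card_le_card fun w hw => by
      rw [Finset.mem_inter] at hw
      exact Finset.mem_filter.mpr
        ⟨hw.1, (G.mem_neighborFinset h w).mp (hH'h (hS hw.2))⟩) hhB
    have h3 := Finset.card_union_add_card_inter B S
    have h4 : ((B ∪ S).filter fun w => G.Adj u w).card ≤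
        (B.filter fun w => G.Adj u w).card + (S.filter fun w => G.Adj u w).card := by
      rw [Finset.filter_union]
      exact Finset.card_union_le _ _
    omega
  have hside : ∀ S T : Finset V, S ⊆ H' → Disjoint T S →
      (A₀ ∩ T).card * (B.card + S.card) ≤ edgesBetween G (A₀ ∩ T) B +
        edgesBetween G (A₀ ∩ T) S + (A₀ ∩ T).card * (2 * k - 1) := by
    intro S T hS hTS
    rw [edgesBetween, edgesBetween, ← Finset.sum_add_distrib, ← smul_eq_mul, ← Finset.sum_const,
      ← smul_eq_mul, ← Finset.sum_const, ← Finset.sum_add_distrib]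
    refine Finset.sum_le_sum fun u hu => ?_
    rw [Finset.mem_inter] at hu
    exact hfar S hS u hu.1 (Finset.disjoint_left.mp hTS hu.2)
  have hA₂H : A₂ ⊆ H' := hAB₂ ▸ Finset.subset_union_left
  have hB₂H : B₂ ⊆ H' := hAB₂ ▸ Finset.subset_union_right
  have hsplit : A₀ ∩ A₂ ∪ A₀ ∩ B₂ = A₀ := by
    rw [← Finset.inter_union_distrib_left, hAB₂]
    exact Finset.inter_eq_left.mpr hA₀H'
  have hdisj₀ : Disjoint (A₀ ∩ A₂) (A₀ ∩ B₂) :=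
    hdisj₂.mono Finset.inter_subset_right Finset.inter_subset_right
  have hij : (A₀ ∩ A₂).card + (A₀ ∩ B₂).card = k := by
    rw [← Finset.card_union_of_disjoint hdisj₀, hsplit, hA₀k]
  have hZ : edgesBetween G (A₀ ∩ A₂) B + edgesBetween G (A₀ ∩ B₂) B = edgesBetween G A₀ B := by
    have := Finset.sum_union hdisj₀ (f := fun u => (B.filter fun w => G.Adj u w).card)
    rw [hsplit] at this
    exact this.symm
  have h1 := hside B₂ A₂ hB₂H hdisj₂
  have h2 := hside A₂ B₂ hA₂H hdisj₂.symm
  refine crossing_cuts_arith hk hij hA₂ hB₂ hc₂.symm hBbig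
    ((edgesBetween_mono_left G hA₀A).trans hE)
    ((edgesBetween_mono_left G Finset.inter_subset_right).trans hE₂)
    ((edgesBetween_mono_left G Finset.inter_subset_right).trans
      ((edgesBetween_comm G B₂ A₂).trans_le hE₂))
    ((edgesBetween_add_edgesBetween_le G Finset.inter_subset_right
      Finset.inter_subset_right).trans (Nat.add_le_add_right hE₂ _)) ?_
  calc _ ≤ _ := Nat.add_le_add h1 h2
    _ = edgesBetween G A₀ B + edgesBetween G (A₀ ∩ A₂) B₂ + edgesBetween G (A₀ ∩ B₂) A₂ +
        ((A₀ ∩ A₂).card + (A₀ ∩ B₂).card) * (2 * k - 1) := by rw [← hZ]; ring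
    _ = _ := by rw [hij]

/-! ### Wheels and stars -/

theorem wheelGraph_isContained {V : Type*} {G : SimpleGraph V} {n : ℕ} {v : V}
    {f : ℕ → V} (hf : IsPathFun G n f) (hcl : G.Adj (f (n - 1)) (f 0))
    (hv : ∀ i, G.Adj v (f i)) : wheelGraph n ⊑ G := by
  have hstep : ∀ a b : Fin n, (a - b).val = 1 → G.Adj (f a) (f b) := by
    intro a b h
    have ha := a.2
    have hb := b.2
    rw [Fin.sub_def] at h
    change (n - b.1 + a.1) % n = 1 at h
    rcases Nat.lt_or_ge (n - b.1 + a.1) n with hlt | hle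
    · rw [Nat.mod_eq_of_lt hlt] at h
      rw [show (a : ℕ) = 0 by omega, show (b : ℕ) = n - 1 by omega]
      exact hcl.symm
    · rw [Nat.mod_eq_sub_mod hle, Nat.mod_eq_of_lt (by omega)] at h
      rw [show (a : ℕ) = b + 1 by omega]
      exact (hf.2 b (by omega)).symm
  refine ⟨⟨⟨Sum.elim (fun i => f i) (fun _ => v), ?_⟩, ?_⟩⟩
  · rintro (a | a) (b | b) h
    · rcases cycleGraph_adj'.mp (by simpa [wheelGraph, graphJoin] using h) with h | h
      · exact hstep a b h
      · exact (hstep b a h).symm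
    · exact (hv a).symm
    · exact hv b
    · exact absurd (Subsingleton.elim a b) (by simpa [wheelGraph, graphJoin] using h)
  · rintro (a | a) (b | b) h
    · exact congrArg _ (Fin.ext (hf.1 a b a.2 b.2 h))
    · exact absurd h (hv a).ne'
    · exact absurd h (hv b).ne
    · exact congrArg _ (Subsingleton.elim a b)

theorem starOfOrder_isContained_compl {V : Type*} {G : SimpleGraph V} {n : ℕ} {v : V}
    {S : Finset V} (hvS : v ∉ S) (hS : ∀ w ∈ S, ¬ G.Adj v w) (hn : n - 1 ≤ S.card) :
    starOfOrder n ⊑ Gᶜ := by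
  obtain ⟨T, hTS, hT⟩ := Finset.exists_subset_card_eq hn
  let e : Fin (n - 1) ≃ T := (T.equivFinOfCardEq hT).symm
  have hadj : ∀ i, Gᶜ.Adj v (e i) := fun i => by
    rw [compl_adj]
    exact ⟨fun h => hvS (h ▸ hTS (e i).2), hS _ (hTS (e i).2)⟩
  refine ⟨⟨⟨Sum.elim (fun _ => v) (fun i => (e i).1), ?_⟩, ?_⟩⟩
  · rintro (a | a) (b | b) h
    · simp [starOfOrder] at h
    · exact hadj b
    · exact (hadj a).symm
    · simp [starOfOrder] at h
  · rintro (a | a) (b | b) h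
    · exact congrArg _ (Subsingleton.elim a b)
    · exact absurd h (hadj b).ne
    · exact absurd h (hadj a).ne'
    · exact congrArg _ (e.injective (Subtype.ext h))

theorem wheelGraph_isContained_or_starOfOrder_isContained_compl {V : Type*} [Fintype V]
    (G : SimpleGraph V) {k : ℕ} (hk : 3 ≤ k) (hV : Fintype.card V = 5 * k - 1) :
    wheelGraph (2 * k) ⊑ G ∨ starOfOrder (2 * k) ⊑ Gᶜ := by
  classical
  by_cases hmiss : ∀ v, ∀ S : Finset V, v ∉ S →
      (S.filter fun w => ¬ G.Adj v w).card ≤ 2 * k - 2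
  · obtain ⟨v, f, hf, hcl, hv⟩ := exists_cycle_in_neighborhood hk hV hmiss
    exact Or.inl (wheelGraph_isContained hf hcl hv)
  · push Not at hmiss
    obtain ⟨v, S, hvS, hS⟩ := hmiss
    exact Or.inr (starOfOrder_isContained_compl (S := S.filter fun w => ¬ G.Adj v w)
      (fun h => hvS (Finset.mem_filter.mp h).1) (fun w hw => (Finset.mem_filter.mp hw).2)
      (by omega))

theorem theorem1p3 (n : ℕ) (hn : 6 ≤ n) (heven : Even n) :
    (∃ R : ℕ, IsRamseyNumber (wheelGraph n) (starOfOrder n) R ∧ R ≤ 5 * n / 2 - 1) ∧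
      ∀ (V : Type*) [Fintype V] (G : SimpleGraph V), Fintype.card V = 5 * n / 2 - 1 →
        wheelGraph n ⊑ G ∨ starOfOrder n ⊑ Gᶜ := by
  obtain ⟨k, rfl⟩ := heven
  rw [← two_mul] at hn ⊢
  rw [show 5 * (2 * k) / 2 - 1 = 5 * k - 1 by omega]
  refine ⟨?_, fun V _ G hV =>
    wheelGraph_isContained_or_starOfOrder_isContained_compl G (by omega) hV⟩
  have hmem : 5 * k - 1 ∈ {N : ℕ | 0 < N ∧ ∀ G : SimpleGraph (Fin N),
      wheelGraph (2 * k) ⊑ G ∨ starOfOrder (2 * k) ⊑ Gᶜ} :=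
    ⟨by omega, fun G => wheelGraph_isContained_or_starOfOrder_isContained_compl G (by omega)
      (Fintype.card_fin _)⟩
  exact ⟨_, ⟨Nat.sInf_mem ⟨_, hmem⟩, fun _ h => Nat.sInf_le h⟩, Nat.sInf_le hmem⟩
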